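/- **Setting.** Let $\mathcal X$ be a measurable space (e.g. $\mathbb R^p$), $\mathcal H$ a real reproducing kernel Hilbert space of functions on $\mathcal X$ with kernel $K$, and $\Phi(x)=K(\cdot,x)$ its (strongly measurable) feature map. Fix $s\ge 0$ and probability measures $P^{(1)},\dots,P^{(s+1)}$ on $\mathcal X$. For every $n$ let $0=z_{0}\le z_{1}\le\dots\le z_{s}\le z_{s+1}=n$ (depending on $n$) be the change points, and let $X_1,\dots,X_n$ (a triangular array) be independent with $X_i\sim P^{(j)}$ for $z_{j-1}<i\le z_j$. Put $n_j=z_j-z_{j-1}$ and assume $n_j/n\to c_j>0$ for each $j$. Let $\mu^{(j)}=\int \Phi\,dP^{(j)}\in\mathcal H$, let $q_d=\dim\operatorname{Span}\{\mu^{(i)}-\mu^{(j)}: i,j\}$, write $(f\otimes g)h=\langle g,h\rangle f$, and let $$\Delta=\tfrac12\sum_{i=1}^{s+1}\sum_{j=1}^{s+1}c_ic_j(\mu^{(i)}-\mu^{(j)})\otimes(\mu^{(i)}-\mu^{(j)})=\sum_{i<j}c_ic_j(\mu^{(i)}-\mu^{(j)})\otimes(\mu^{(i)}-\mu^{(j)}).$$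 With $Y_i=\Phi(X_i)$ and $\bar Y=\frac1n\sum_{i\le n} Y_i$, let $M_n=\frac1n\sum_{i=1}^n(Y_i-\bar Y)\otimes(Y_i-\bar Y)$. Let $\alpha_n$ be integers with $2\le\alpha_n\le n$ for all large $n$, $r=\lfloor n/\alpha_n\rfloor$, $\mathcal S_m=\{(m-1)\alpha_n+1,\dots,m\alpha_n\}$ for $m<r$ and $\mathcal S_r=\{(r-1)\alpha_n+1,\dots,n\}$, and $$\Sigma_{pooled,n}=\frac1r\sum_{m=1}^r\frac1{|\mathcal S_m|-1}\sum_{i\in\mathcal S_m}(Y_i-\bar Y_m)\otimes(Y_i-\bar Y_m),\qquad \bar Y_m=\frac1{|\mathcal S_m|}\sum_{i\in\mathcal S_m}Y_i,\qquad \Delta_n=M_n-\Sigma_{pooled,n}.$$ Assume moreover that the proportions converge at least at the rate below: $n_j/n-c_j=O\big(n^{-1/2}+\alpha_n/n\big)$ for each $j$ (for instance $z_j=\lfloor n\tau_j\rfloor$ with fixed $\tau_j$). **Theorem.** If there is a constant $C$ with $K(X_i,X_i)\le C$ almost surely for all $n$ and all $i\le n$, then $\Delta$ is a Hilbert–Schmidt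 operator, so are all $\Delta_n-\Delta$, and $$\|\Delta_n-\Delta\|_{HS}=O_p\Big(\sqrt{\tfrac1n}+\tfrac{\alpha_n}{n}\Big).$$ Furthermore, let $v_1,\dots,v_{q_d}$ be any orthonormal eigenfunctions of $\Delta$ for its $q_d$ largest eigenvalues $\lambda_1\ge\dots\ge\lambda_{q_d}$ (counted with multiplicity), and let $\hat v_1,\dots,\hat v_{q_d}$ be any orthonormal eigenfunctions of $\Delta_n$ for its $q_d$ largest eigenvalues, in decreasing order. For $k\le q_d$ let $P_k$ and $\hat P_k$ be the orthogonal projections onto $\operatorname{Span}\{v_l:\lambda_l=\lambda_k\}$ and $\operatorname{Span}\{\hat v_l:\lambda_l=\lambda_k\}$; if $\lambda_k$ is simple these are the lines spanned by the $k$-th eigenfunctions $v_k$ and $\hat v_k$. Then, in operator norm, $$\|\hat P_k-P_k\|=O_p\Big(\sqrt{\tfrac1n}+\tfrac{\alpha_n}{n}\Big),\qquad k=1,\dots,q_d .$$ -/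

import Mathlib

open MeasureTheory ProbabilityTheory Filter Topology

noncomputable section

namespace CKPCA

section Hilbert

variable {H : Type*} [NormedAddCommGroup H] [InnerProductSpace ℝ H]

/-- `f ⊗ g`, the operator `h ↦ ⟨g, h⟩ f`. -/
def tensor (f g : H) : H →L[ℝ] H := InnerProductSpace.rankOne ℝ f g

/-- `T` is Hilbert–Schmidt, read off in the orthonormal basis `b`: `∑ ‖T bᵢ‖² < ∞`. -/
def IsHilbertSchmidt {ι : Type*} (b : HilbertBasis ι ℝ H) (T : H →L[ℝ] H) : Prop :=
  Summable fun i => ‖T (b i)‖ ^ 2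

/-- The Hilbert–Schmidt norm `(∑ ‖T bᵢ‖²)^{1/2}`, meaningful for Hilbert–Schmidt `T`. -/
def hsNorm {ι : Type*} (b : HilbertBasis ι ℝ H) (T : H →L[ℝ] H) : ℝ :=
  Real.sqrt (∑' i, ‖T (b i)‖ ^ 2)

/-- The average of `y i` over `i ∈ S`. -/
def avg (S : Finset ℕ) (y : ℕ → H) : H :=
  (S.card : ℝ)⁻¹ • ∑ i ∈ S, y i

/-- The centred sum of squares `∑_{i ∈ S} (yᵢ - ȳ_S) ⊗ (yᵢ - ȳ_S)`. -/
def scatter (S : Finset ℕ) (y : ℕ → H) : H →L[ℝ] H :=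
  ∑ i ∈ S, tensor (y i - avg S y) (y i - avg S y)

/-- The sample covariance operator `M_n` of `y 0, …, y (n-1)`, normalised by `1 / n`. -/
def sampleCov (n : ℕ) (y : ℕ → H) : H →L[ℝ] H :=
  (n : ℝ)⁻¹ • scatter (Finset.range n) y

/-- The `m`-th of the `r = ⌊n / a⌋` segments (`m = 0, …, r - 1`): consecutive blocks of length
`a`, the last one extended up to the end of the sample. -/
def segment (n a m : ℕ) : Finset ℕ :=
  Finset.Ico (m * a) (if m + 1 = n / a then n else (m + 1) * a)

/-- The segment-based estimator of the pooled covariance operator: the average over the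
`⌊n / a⌋` segments of the unbiased sample covariance operators of the segments. -/
def pooledCov (n a : ℕ) (y : ℕ → H) : H →L[ℝ] H :=
  ((n / a : ℕ) : ℝ)⁻¹ • ∑ m ∈ Finset.range (n / a),
    (((segment n a m).card : ℝ) - 1)⁻¹ • scatter (segment n a m) y

/-- The corrected estimator `Δ_n = M_n - Σ_{pooled,n}`. -/
def deltaHat (n a : ℕ) (y : ℕ → H) : H →L[ℝ] H :=
  sampleCov n y - pooledCov n a y

/-- The population operator
`Δ = ½ ∑ᵢ ∑ⱼ cᵢ cⱼ (μᵢ - μⱼ) ⊗ (μᵢ - μⱼ) = ∑_{i<j} cᵢ cⱼ (μᵢ - μⱼ) ⊗ (μᵢ - μⱼ)`. -/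
def delta {k : ℕ} (c : Fin k → ℝ) (mu : Fin k → H) : H →L[ℝ] H :=
  (1 / 2 : ℝ) • ∑ i, ∑ j, (c i * c j) • tensor (mu i - mu j) (mu i - mu j)

/-- The central distribution deviation subspace, the span of all differences `μᵢ - μⱼ`. -/
def deviationSubspace {k : ℕ} (mu : Fin k → H) : Submodule ℝ H :=
  Submodule.span ℝ (Set.range fun p : Fin k × Fin k => mu p.1 - mu p.2)

/-- The structural dimension `q_d`. -/
def structuralDim {k : ℕ} (mu : Fin k → H) : ℕ :=
  Module.finrank ℝ (deviationSubspace mu)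

/-- `v 0, …, v (q-1)` are orthonormal eigenvectors of `T` for its `q` largest eigenvalues,
counted with multiplicity and listed in decreasing order `lam 0 ≥ … ≥ lam (q-1)`. -/
structure IsLeadingEigensystem (T : H →L[ℝ] H) {q : ℕ} (lam : Fin q → ℝ) (v : Fin q → H) :
    Prop where
  orthonormal : Orthonormal ℝ v
  eigen : ∀ l, T (v l) = lam l • v l
  antitone : Antitone lam
  leading : ∀ (w : H) (r : ℝ), w ≠ 0 → T w = r • w → (∀ l, inner ℝ (v l) w = 0) →
    ∀ l, r ≤ lam l

/-- The orthogonal projection onto the span of the `v l` with `l ∈ I`. -/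
def spanProj {q : ℕ} (v : Fin q → H) (I : Finset (Fin q)) : H →L[ℝ] H :=
  haveI : FiniteDimensional ℝ (Submodule.span ℝ (v '' (I : Set (Fin q)))) :=
    FiniteDimensional.span_of_finite ℝ (Set.toFinite _)
  (Submodule.span ℝ (v '' (I : Set (Fin q)))).starProjection

end Hilbert

section Kernel

variable {𝒳 : Type*} (H : Type*) [NormedAddCommGroup H] [InnerProductSpace ℝ H] [CompleteSpace H]
  [RKHS ℝ H 𝒳 ℝ]

/-- The scalar kernel `K(x, y)` of a real reproducing kernel Hilbert space of functions. -/
def kern (x y : 𝒳) : ℝ := RKHS.kernel H x y 1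

/-- The feature map `Φ(x) = K(·, x)`. -/
def feature (x : 𝒳) : H := RKHS.kerFun H x (1 : ℝ)

/-- The mean element `E Φ(X)` for `X ∼ Q`. -/
def meanElement [MeasurableSpace 𝒳] (Q : Measure 𝒳) : H := ∫ x, feature H x ∂Q

end Kernel

/-- `Z n = O_p(a n)` as `n → ∞`. -/
def IsBigOp {Ω : Type*} [MeasurableSpace Ω] (P : Measure Ω) (Z : ℕ → Ω → ℝ) (a : ℕ → ℝ) : Prop :=
  ∀ ε : ℝ, 0 < ε → ∃ M : ℝ, 0 < M ∧
    ∀ᶠ n in atTop, P {ω | M * a n < |Z n ω|} ≤ ENNReal.ofReal ε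

/-- The rate `n^{-1/2} + α_n / n`. -/
def rate (α : ℕ → ℕ) (n : ℕ) : ℝ := Real.sqrt (1 / (n : ℝ)) + (α n : ℝ) / (n : ℝ)

end CKPCA

end

set_option linter.unusedSectionVars false

/-! The error `Δ_n - Δ` is controlled in an arbitrary Hilbert space `V`, for a bilinear product `B`
with `‖B f g‖ ≤ ‖f‖ * ‖g‖` in place of the tensor product. It has three parts. Fluctuation about the
mean: the centred sum of squares over a block is a sum of independent terms minus a quadratic
correction that is Lipschitz on bounded data, so its variance is at most linear in the block size.
Disjoint segments are uncorrelated, so averaging over them leaves variance `O(1/n)`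
(`BoundedSample.integral_norm_bilinDeltaHat_sub_sq_le`), and Chebyshev gives `n^{-1/2}`. Bias: the
covariances of the observations cancel between `M_n` and the pooled estimator up to `O(α_n/n)`,
since the two weightings almost agree. The dispersion of the means inside a segment vanishes unless
a change point falls there; this concerns at most `s + 2` segments, each of weight `1/r ≤ 2 α_n/n`
(`BoundedSample.norm_bilinDeltaMean_sub_le`). Proportions: what remains is `Δ` with `n_j/n` in place
of `c_j`, and the assumed rate applies (`isBigO_bilinDelta_sub`). Taking `V` to be the square
summable families in `H` indexed by a Hilbert basis, and `B = hsTensor b`, turns the bound into one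
for the Hilbert–Schmidt norm; `Represents` links operators with such families.

The eigenprojections need no further probability. The `q_d` leading eigenvalues of `Δ` are positive
and `Δ` vanishes on the complement of their eigenvectors (`IsLeadingEigensystem.delta_pos_and_ker`),
so each `λ_k` is at positive distance from the rest of the spectrum. Weyl's inequality and this gap
give a Davis–Kahan estimate whose constant depends on `Δ` only (`exists_norm_spanProj_sub_le`),
applied outcome by outcome. -/

namespace CKPCA

/-! ### Symmetric finite-rank operators: Rayleigh bounds, Weyl's inequality and the spectral gap. -/

section Spectral

variable {H : Type*} [NormedAddCommGroup H] [InnerProductSpace ℝ H]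

/-- The range of `T` lies in a finite-dimensional subspace. -/
def HasFiniteRank (T : H →L[ℝ] H) : Prop :=
  ∃ R : Submodule ℝ H, FiniteDimensional ℝ R ∧ ∀ x, T x ∈ R

theorem HasFiniteRank.add {S T : H →L[ℝ] H} (hS : HasFiniteRank S) (hT : HasFiniteRank T) :
    HasFiniteRank (S + T) := by
  obtain ⟨R, hR, h⟩ := hS
  obtain ⟨R', hR', h'⟩ := hT
  exact ⟨R ⊔ R', inferInstance, fun x => Submodule.add_mem_sup (h x) (h' x)⟩

theorem HasFiniteRank.smul {T : H →L[ℝ] H} (hT : HasFiniteRank T) (a : ℝ) :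
    HasFiniteRank (a • T) := by
  obtain ⟨R, hR, h⟩ := hT
  exact ⟨R, hR, fun x => R.smul_mem a (h x)⟩

theorem HasFiniteRank.sum {ι : Type*} (s : Finset ι) {T : ι → H →L[ℝ] H}
    (hT : ∀ i ∈ s, HasFiniteRank (T i)) : HasFiniteRank (∑ i ∈ s, T i) :=
  Finset.sum_induction _ _ (fun _ _ => HasFiniteRank.add)
    ⟨⊥, inferInstance, fun x => by simp⟩ hT

theorem hasFiniteRank_tensor (f g : H) : HasFiniteRank (tensor f g) :=
  ⟨Submodule.span ℝ {f}, inferInstance, fun x => by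
    simpa [tensor] using Submodule.smul_mem _ _ (Submodule.mem_span_singleton_self f)⟩

theorem tensor_apply (f g h : H) : tensor f g h = inner ℝ g h • f := by
  simp [tensor]

theorem isSymmetric_tensor_self (f : H) : (tensor f f : H →ₗ[ℝ] H).IsSymmetric := by
  intro x y
  simp [tensor_apply, inner_smul_left, inner_smul_right, real_inner_comm, mul_comm]

/-- `T` is symmetric of finite rank. -/
def IsSymmFiniteRank (T : H →L[ℝ] H) : Prop :=
  (T : H →ₗ[ℝ] H).IsSymmetric ∧ HasFiniteRank T

theorem IsSymmFiniteRank.add {S T : H →L[ℝ] H} (hS : IsSymmFiniteRank S)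
    (hT : IsSymmFiniteRank T) : IsSymmFiniteRank (S + T) :=
  ⟨by simpa using hS.1.add hT.1, hS.2.add hT.2⟩

theorem IsSymmFiniteRank.smul {T : H →L[ℝ] H} (hT : IsSymmFiniteRank T) (a : ℝ) :
    IsSymmFiniteRank (a • T) :=
  ⟨by simpa using hT.1.smul (c := a) (by simp), hT.2.smul a⟩

theorem IsSymmFiniteRank.sub {S T : H →L[ℝ] H} (hS : IsSymmFiniteRank S)
    (hT : IsSymmFiniteRank T) : IsSymmFiniteRank (S - T) := by
  have := hS.add (hT.smul (-1))
  rwa [neg_one_smul, ← sub_eq_add_neg] at this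

theorem IsSymmFiniteRank.sum {ι : Type*} (s : Finset ι) {T : ι → H →L[ℝ] H}
    (hT : ∀ i ∈ s, IsSymmFiniteRank (T i)) : IsSymmFiniteRank (∑ i ∈ s, T i) :=
  Finset.sum_induction _ _ (fun _ _ => IsSymmFiniteRank.add)
    ⟨by intro x y; simp, ⊥, inferInstance, fun x => by simp⟩ hT

theorem isSymmFiniteRank_tensor_self (f : H) : IsSymmFiniteRank (tensor f f) :=
  ⟨isSymmetric_tensor_self f, hasFiniteRank_tensor f f⟩

theorem isSymmFiniteRank_scatter (S : Finset ℕ) (y : ℕ → H) : IsSymmFiniteRank (scatter S y) :=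
  IsSymmFiniteRank.sum _ fun _ _ => isSymmFiniteRank_tensor_self _

theorem isSymmFiniteRank_deltaHat (n a : ℕ) (y : ℕ → H) : IsSymmFiniteRank (deltaHat n a y) :=
  ((isSymmFiniteRank_scatter _ y).smul _).sub
    ((IsSymmFiniteRank.sum _ fun _ _ => (isSymmFiniteRank_scatter _ y).smul _).smul _)

theorem isSymmFiniteRank_delta {k : ℕ} (c : Fin k → ℝ) (mu : Fin k → H) :
    IsSymmFiniteRank (delta c mu) :=
  (IsSymmFiniteRank.sum _ fun _ _ => IsSymmFiniteRank.sum _ fun _ _ =>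
    (isSymmFiniteRank_tensor_self _).smul _).smul _

/-- The field `leading` speaks of eigenvectors only. The spectral theorem on a finite-dimensional
invariant subspace of the complement of the `v j` extends it to the quadratic form at any `w` there.
-/
theorem IsLeadingEigensystem.inner_apply_le_of_orthogonal {T : H →L[ℝ] H}
    (hT : IsSymmFiniteRank T) {q : ℕ} {lam : Fin q → ℝ} {v : Fin q → H}
    (h : IsLeadingEigensystem T lam v) (l : Fin q) {w : H} (hw : ∀ j, inner ℝ (v j) w = 0) :
    inner ℝ (T w) w ≤ lam l * ‖w‖ ^ 2 := by
  obtain ⟨hs, R, hR, hTR⟩ := hT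
  -- Adjoining `w` to `R` keeps the space finite-dimensional, and it stays invariant because `T`
  -- maps everything into `R` and preserves the complement of its eigenvectors.
  set E : Submodule ℝ H := (Submodule.span ℝ {w} ⊔ R) ⊓ (Submodule.span ℝ (Set.range v))ᗮ with hE
  have horth : ∀ x, x ∈ (Submodule.span ℝ (Set.range v))ᗮ ↔ ∀ j, inner ℝ (v j) x = 0 := by
    intro x
    rw [Submodule.mem_orthogonal]
    refine ⟨fun H j => H _ (Submodule.subset_span ⟨j, rfl⟩), fun H u hu => ?_⟩
    induction hu using Submodule.span_induction with
    | mem u hu => obtain ⟨j, rfl⟩ := hu; exact H j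
    | zero => simp
    | add a b _ _ ha hb => simp [inner_add_left, ha, hb]
    | smul a b _ hb => simp [inner_smul_left, hb]
  have hinv : ∀ x ∈ E, (T : H →ₗ[ℝ] H) x ∈ E := by
    intro x hx
    refine ⟨Submodule.mem_sup_right (hTR x), (horth _).2 fun j => ?_⟩
    have : inner ℝ (T (v j)) x = inner ℝ (v j) (T x) := hs (v j) x
    change inner ℝ (v j) (T x) = 0
    rw [← this, h.eigen, inner_smul_left, (horth x).1 hx.2 j, mul_zero]
  have hwE : w ∈ E := ⟨Submodule.mem_sup_left (Submodule.mem_span_singleton_self w),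
    (horth w).2 hw⟩
  have hfin : FiniteDimensional ℝ E := Submodule.finiteDimensional_inf_left _ _
  have hs' := hs.restrict_invariant hinv
  set e := hs'.eigenvectorBasis rfl
  set r := hs'.eigenvalues rfl
  set w' : E := ⟨w, hwE⟩
  have hr : ∀ i, r i ≤ lam l := by
    intro i
    have h1 := hs'.apply_eigenvectorBasis rfl i
    refine h.leading (e i : H) (r i) ?_ ?_ (fun j => (horth _).1 (e i).2.2 j) l
    · intro h0
      have := e.orthonormal.1 i
      rw [show e i = 0 from Subtype.ext h0] at this
      simp at this
    · exact congrArg (Subtype.val) h1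
  have key : inner ℝ (T w) w = ∑ i, r i * inner ℝ w' (e i) ^ 2 := by
    have h1 : inner ℝ (T w) w = inner ℝ ((T : H →ₗ[ℝ] H).restrict hinv w') w' := rfl
    rw [h1, ← e.sum_inner_mul_inner]
    refine Finset.sum_congr rfl fun i _ => ?_
    rw [hs' w' (e i), hs'.apply_eigenvectorBasis rfl i, real_inner_comm w' (e i), sq]
    change inner ℝ w' (r i • e i) * _ = _
    rw [inner_smul_right]
    ring
  have hn : ‖w‖ ^ 2 = ∑ i, inner ℝ w' (e i) ^ 2 := by
    have : ‖w‖ ^ 2 = inner ℝ w' w' := by rw [real_inner_self_eq_norm_sq]; rfl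
    rw [this, ← e.sum_inner_mul_inner]
    refine Finset.sum_congr rfl fun i _ => ?_
    rw [real_inner_comm w' (e i), sq]
  rw [key, hn, Finset.mul_sum]
  exact Finset.sum_le_sum fun i _ => mul_le_mul_of_nonneg_right (hr i) (sq_nonneg _)

theorem inner_sub_sum_eq_zero {q : ℕ} {v : Fin q → H} (hv : Orthonormal ℝ v) (x : H) (j : Fin q) :
    inner ℝ (v j) (x - ∑ l, inner ℝ (v l) x • v l) = 0 := by
  rw [inner_sub_right, hv.inner_right_fintype, sub_self]

theorem norm_sq_eq_sum_add {q : ℕ} {v : Fin q → H} (hv : Orthonormal ℝ v) (x : H) :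
    ‖x‖ ^ 2 = ∑ l, inner ℝ (v l) x ^ 2 + ‖x - ∑ l, inner ℝ (v l) x • v l‖ ^ 2 := by
  set p := ∑ l, inner ℝ (v l) x • v l with hp
  have h0 : inner ℝ p (x - p) = 0 := by
    conv_lhs => rw [hp, sum_inner]
    refine Finset.sum_eq_zero fun l _ => ?_
    rw [inner_smul_left, inner_sub_sum_eq_zero hv, mul_zero]
  have h1 : ‖p‖ ^ 2 = ∑ l, inner ℝ (v l) x ^ 2 := by
    rw [← real_inner_self_eq_norm_sq]
    conv_lhs => rw [hp, hv.inner_sum]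
    simp [sq]
  have h2 : x = p + (x - p) := by abel
  conv_lhs => rw [h2]
  rw [norm_add_sq_real, h0, h1]
  ring

/-- One half of the Courant–Fischer principle. The form splits over `x = p + w`: it is diagonal on
the span of the `v j`, where only indices `j ≥ l` survive, and bounded by the previous orthogonal
estimate on `w`. -/
theorem IsLeadingEigensystem.inner_apply_le {T : H →L[ℝ] H}
    (hT : IsSymmFiniteRank T) {q : ℕ} {lam : Fin q → ℝ} {v : Fin q → H}
    (h : IsLeadingEigensystem T lam v) (l : Fin q) {x : H} (hx : ∀ j < l, inner ℝ (v j) x = 0) :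
    inner ℝ (T x) x ≤ lam l * ‖x‖ ^ 2 := by
  set p := ∑ l, inner ℝ (v l) x • v l with hp
  set w := x - p with hw
  have hvw : ∀ j, inner ℝ (v j) w = 0 := inner_sub_sum_eq_zero h.orthonormal x
  have hTp : T p = ∑ j, inner ℝ (v j) x • lam j • v j := by simp [hp, h.eigen]
  have h1 : inner ℝ (T p) x = ∑ j, lam j * inner ℝ (v j) x ^ 2 := by
    rw [hTp, sum_inner]
    refine Finset.sum_congr rfl fun j _ => ?_
    simp [inner_smul_left]; ring
  have h2 : inner ℝ (T w) p = 0 := by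
    have : inner ℝ (T w) p = inner ℝ w (T p) := hT.1 w p
    rw [this, hTp, inner_sum]
    refine Finset.sum_eq_zero fun j _ => ?_
    rw [inner_smul_right, inner_smul_right, real_inner_comm (v j) w, hvw j]; simp
  have h3 := h.inner_apply_le_of_orthogonal hT l hvw
  have hxp : x = p + w := by simp [hw]
  have h4 : inner ℝ (T x) x = inner ℝ (T p) x + inner ℝ (T w) w := by
    have : inner ℝ (T w) x = inner ℝ (T w) w := by
      conv_lhs => rw [hxp]
      rw [inner_add_right, h2, zero_add]
    rw [← this, ← inner_add_left, ← map_add, ← hxp]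
  rw [h4, h1, norm_sq_eq_sum_add h.orthonormal x, mul_add, Finset.mul_sum]
  refine add_le_add (Finset.sum_le_sum fun j _ => ?_) h3
  rcases lt_or_ge j l with hj | hj
  · rw [hx j hj]; simp
  · exact mul_le_mul_of_nonneg_right (h.antitone hj) (sq_nonneg _)

/-- Weyl's inequality. -/
theorem IsLeadingEigensystem.eigenvalue_le_add {S T : H →L[ℝ] H} (hT : IsSymmFiniteRank T)
    {q : ℕ} {lam lam' : Fin q → ℝ} {v v' : Fin q → H}
    (h : IsLeadingEigensystem T lam v) (h' : IsLeadingEigensystem S lam' v') (l : Fin q) :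
    lam' l ≤ lam l + ‖S - T‖ := by
  have hl : (l : ℕ) < q := l.2
  let ι₁ : Fin (l + 1) → Fin q := Fin.castLE hl
  have hι₁ : Function.Injective ι₁ := Fin.castLE_injective _
  let G : (Fin (l + 1) → ℝ) →ₗ[ℝ] H := Fintype.linearCombination ℝ (v' ∘ ι₁)
  let F : (Fin (l + 1) → ℝ) →ₗ[ℝ] (Fin l → ℝ) :=
    LinearMap.pi fun i => (innerₛₗ ℝ (v (Fin.castLE hl.le i))) ∘ₗ G
  -- Dimension count: `l + 1` coefficients against `l` conditions give a nonzero combination of `v'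
  -- 0, …, v' l` orthogonal to `v 0, …, v (l-1)`.
  have hF : LinearMap.ker F ≠ ⊥ := LinearMap.ker_ne_bot_of_finrank_lt (by simp)
  obtain ⟨a, haF, ha⟩ := (Submodule.ne_bot_iff _).1 hF
  have horth : ∀ j < l, inner ℝ (v j) (G a) = 0 := fun j hj =>
    congrFun (LinearMap.mem_ker.1 haF) ⟨j, hj⟩
  have hon : Orthonormal ℝ (v' ∘ ι₁) := h'.orthonormal.comp _ hι₁
  have hG : G a = ∑ j, a j • (v' ∘ ι₁) j := Fintype.linearCombination_apply ..
  have hSG : S (G a) = ∑ j, (lam' (ι₁ j) * a j) • (v' ∘ ι₁) j := by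
    rw [hG, map_sum]
    refine Finset.sum_congr rfl fun j _ => ?_
    rw [map_smul, Function.comp_apply, h'.eigen, smul_smul, mul_comm]
  have hnorm : ‖G a‖ ^ 2 = ∑ j, a j ^ 2 := by
    rw [← real_inner_self_eq_norm_sq, hG, hon.inner_sum]
    simp [sq]
  have hpos : 0 < ‖G a‖ ^ 2 := by
    rw [hnorm]
    obtain ⟨j, hj⟩ := Function.ne_iff.1 ha
    exact Finset.sum_pos' (fun _ _ => sq_nonneg _) ⟨j, Finset.mem_univ _, by
      have : a j ≠ 0 := hj
      positivity⟩
  have hS : lam' l * ‖G a‖ ^ 2 ≤ inner ℝ (S (G a)) (G a) := by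
    rw [hSG, hnorm, hG, hon.inner_sum, Finset.mul_sum]
    refine Finset.sum_le_sum fun j _ => ?_
    have : lam' l ≤ lam' (ι₁ j) := h'.antitone (Nat.lt_succ_iff.1 j.2)
    simp only [map_mul, conj_trivial, mul_assoc, ← sq]
    exact mul_le_mul_of_nonneg_right this (sq_nonneg _)
  have hle := h.inner_apply_le hT l horth
  have hd : inner ℝ ((S - T) (G a)) (G a) ≤ ‖S - T‖ * ‖G a‖ ^ 2 := by
    refine (real_inner_le_norm _ _).trans ?_
    rw [sq, ← mul_assoc]
    exact mul_le_mul_of_nonneg_right ((S - T).le_opNorm _) (norm_nonneg _)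
  rw [sub_apply, inner_sub_left] at hd
  refine le_of_mul_le_mul_right ?_ hpos
  rw [add_mul]
  linarith

/-- An eigenprojection lower bound: a vector which is far from the eigenspace of `lam k` is far
from being an eigenvector for a value near `lam k`. -/
theorem gap_sq_mul_le {T : H →L[ℝ] H} (hT : (T : H →ₗ[ℝ] H).IsSymmetric)
    {q : ℕ} {lam : Fin q → ℝ} {v : Fin q → H} (hv : Orthonormal ℝ v)
    (hTv : ∀ l, T (v l) = lam l • v l) (hker : ∀ w, (∀ l, inner ℝ (v l) w = 0) → T w = 0)
    {k : Fin q} {g ν : ℝ} (hg : 0 ≤ g) (hg0 : g ≤ |lam k|)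
    (hgap : ∀ l, lam l ≠ lam k → g ≤ |lam l - lam k|) (hν : |ν - lam k| ≤ g / 2) (u : H) :
    (g / 2) ^ 2 * (‖u‖ ^ 2 - ∑ l with lam l = lam k, inner ℝ (v l) u ^ 2)
      ≤ ‖T u - ν • u‖ ^ 2 := by
  set w := u - ∑ l, inner ℝ (v l) u • v l with hw
  have hcoef : ∀ l, inner ℝ (v l) (T u - ν • u) = (lam l - ν) * inner ℝ (v l) u := by
    intro l
    have : inner ℝ (v l) (T u) = inner ℝ (T (v l)) u := (hT (v l) u).symm
    rw [inner_sub_right, this, hTv, inner_smul_left, inner_smul_right]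
    simp; ring
  have hTw : T u = ∑ l, inner ℝ (v l) u • lam l • v l := by
    have h0 := hker w (inner_sub_sum_eq_zero hv u)
    rw [hw, map_sub, sub_eq_zero] at h0
    rw [h0]; simp [hTv]
  have hrest : T u - ν • u - ∑ l, inner ℝ (v l) (T u - ν • u) • v l = -(ν • w) := by
    simp_rw [hcoef, hw, hTw, smul_sub, Finset.smul_sum, smul_smul, sub_mul, sub_smul,
      Finset.sum_sub_distrib]
    simp_rw [mul_comm]
    abel
  rw [norm_sq_eq_sum_add hv (T u - ν • u), hrest, norm_sq_eq_sum_add hv u, ← hw, norm_neg, norm_smul,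
    mul_pow, Real.norm_eq_abs, sq_abs]
  rw [← Finset.sum_filter_add_sum_filter_not Finset.univ (fun l => lam l = lam k)
    (fun l => inner ℝ (v l) u ^ 2), add_assoc, add_sub_cancel_left, mul_add]
  have habs := abs_le.1 hν
  -- Coordinates outside the block of `lam k` are multiplied by `lam l - ν`, and the part orthogonal
  -- to all `v l` by `-ν`. Both factors have modulus at least `g / 2`, the second because `g ≤ |lam
  -- k|` treats the kernel as one more eigenvalue, `0`.
  refine add_le_add ?_ ?_
  · rw [Finset.mul_sum]
    refine (Finset.sum_le_sum (g := fun l => inner ℝ (v l) (T u - ν • u) ^ 2) fun l hl => ?_).trans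
      (Finset.sum_le_sum_of_subset_of_nonneg (Finset.filter_subset _ _) fun _ _ _ => sq_nonneg _)
    rw [hcoef, mul_pow]
    refine mul_le_mul_of_nonneg_right ?_ (sq_nonneg _)
    have h1 := hgap l (Finset.mem_filter.1 hl).2
    rw [← sq_abs (lam l - ν)]
    refine pow_le_pow_left₀ (by positivity) ?_ 2
    have h2 : |lam l - lam k| ≤ |lam l - ν| + |ν - lam k| := abs_sub_le _ _ _
    linarith
  · refine mul_le_mul_of_nonneg_right ?_ (sq_nonneg _)
    rw [← sq_abs ν]
    refine pow_le_pow_left₀ (by positivity) ?_ 2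
    have h2 : |lam k| - |ν| ≤ |lam k - ν| := abs_sub_abs_le_abs_sub _ _
    rw [abs_sub_comm] at h2
    linarith

/-! ### Projections onto spans of eigenvectors and the Davis–Kahan bound. -/

theorem spanProj_apply {q : ℕ} {v : Fin q → H} (hv : Orthonormal ℝ v) (I : Finset (Fin q)) (x : H) :
    spanProj v I x = ∑ l ∈ I, inner ℝ (v l) x • v l := by
  have : FiniteDimensional ℝ (Submodule.span ℝ (v '' (I : Set (Fin q)))) :=
    FiniteDimensional.span_of_finite ℝ (Set.toFinite _)
  unfold spanProj
  apply Submodule.eq_starProjection_of_mem_of_inner_eq_zero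
  · exact Submodule.sum_mem _ fun l hl => Submodule.smul_mem _ _
      (Submodule.subset_span ⟨l, hl, rfl⟩)
  · intro w hw
    induction hw using Submodule.span_induction with
    | mem u hu =>
      obtain ⟨j, hj, rfl⟩ := hu
      rw [real_inner_comm, inner_sub_right, hv.inner_right_sum _ hj, sub_self]
    | zero => simp
    | add a b _ _ ha hb => simp [inner_add_right, ha, hb]
    | smul a b _ hb => simp [inner_smul_right, hb]

theorem norm_spanProj_le {q : ℕ} (v : Fin q → H) (I : Finset (Fin q)) : ‖spanProj v I‖ ≤ 1 :=
  have : FiniteDimensional ℝ (Submodule.span ℝ (v '' (I : Set (Fin q)))) :=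
    FiniteDimensional.span_of_finite ℝ (Set.toFinite _)
  Submodule.starProjection_norm_le _

theorem norm_sub_spanProj_sq {q : ℕ} {v : Fin q → H} (hv : Orthonormal ℝ v) (I : Finset (Fin q))
    (u : H) : ‖u - spanProj v I u‖ ^ 2 = ‖u‖ ^ 2 - ∑ l ∈ I, inner ℝ (v l) u ^ 2 := by
  have h1 : inner ℝ u (spanProj v I u) = ∑ l ∈ I, inner ℝ (v l) u ^ 2 := by
    rw [spanProj_apply hv, inner_sum]
    refine Finset.sum_congr rfl fun l _ => ?_
    rw [inner_smul_right, real_inner_comm, sq]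
  have h2 : ‖spanProj v I u‖ ^ 2 = ∑ l ∈ I, inner ℝ (v l) u ^ 2 := by
    rw [← real_inner_self_eq_norm_sq, spanProj_apply hv, hv.inner_sum]
    simp [sq]
  rw [norm_sub_sq_real, h1, h2]
  ring

/-- For projections, `P' - P = (1 - P) P' - P (1 - P')`, and the last product is the adjoint of `(1
- P') P`. Each product is therefore controlled by how far the basis vectors of one span lie from the
other, at a cost of at most `q` terms. -/
theorem norm_spanProj_sub_spanProj_le [CompleteSpace H] {q : ℕ} {v v' : Fin q → H}
    (hv : Orthonormal ℝ v) (hv' : Orthonormal ℝ v') (I : Finset (Fin q)) {δ : ℝ} (hδ : 0 ≤ δ)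
    (h : ∀ l ∈ I, ‖v' l - spanProj v I (v' l)‖ ≤ δ) (h' : ∀ l ∈ I, ‖v l - spanProj v' I (v l)‖ ≤ δ) :
    ‖spanProj v' I - spanProj v I‖ ≤ 2 * (q * δ) := by
  have aux : ∀ {u w : Fin q → H}, Orthonormal ℝ u → (∀ l ∈ I, ‖u l - spanProj w I (u l)‖ ≤ δ) →
      ‖(1 - spanProj w I) * spanProj u I‖ ≤ q * δ := by
    intro u w hu huw
    refine ContinuousLinearMap.opNorm_le_bound _ (by positivity) fun x => ?_
    have : ((1 - spanProj w I) * spanProj u I) x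
        = ∑ l ∈ I, inner ℝ (u l) x • (u l - spanProj w I (u l)) := by
      simp [spanProj_apply hu, smul_sub]
    rw [this]
    calc _ ≤ ∑ l ∈ I, ‖x‖ * δ := by
          refine norm_sum_le_of_le _ fun l hl => ?_
          rw [norm_smul]
          refine mul_le_mul ?_ (huw l hl) (norm_nonneg _) (norm_nonneg _)
          simpa [hu.1 l] using norm_inner_le_norm (𝕜 := ℝ) (u l) x
      _ = I.card * (‖x‖ * δ) := by simp
      _ ≤ q * (‖x‖ * δ) := by
          gcongr
          simpa using Finset.card_le_univ I
      _ = _ := by ring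
  have hsa : ∀ u : Fin q → H, IsSelfAdjoint (spanProj u I) := fun u => by
    have : FiniteDimensional ℝ (Submodule.span ℝ (u '' (I : Set (Fin q)))) :=
      FiniteDimensional.span_of_finite ℝ (Set.toFinite _)
    exact isSelfAdjoint_starProjection _
  have hadj : ‖spanProj v I * (1 - spanProj v' I)‖ = ‖(1 - spanProj v' I) * spanProj v I‖ := by
    rw [← norm_star]
    congr 1
    rw [star_mul, (hsa v).star_eq, star_sub, star_one, (hsa v').star_eq]
  have hdec : spanProj v' I - spanProj v I
      = (1 - spanProj v I) * spanProj v' I - spanProj v I * (1 - spanProj v' I) := by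
    noncomm_ring
  rw [hdec]
  refine (norm_sub_le _ _).trans ?_
  rw [hadj]
  linarith [aux hv' h, aux hv h']

/-- A Davis–Kahan bound for the eigenprojections of a leading eigensystem. -/
theorem exists_norm_spanProj_sub_le [CompleteSpace H] {T : H →L[ℝ] H} (hT : IsSymmFiniteRank T)
    {q : ℕ} {lam : Fin q → ℝ} {v : Fin q → H} (h : IsLeadingEigensystem T lam v)
    (hpos : ∀ l, 0 < lam l) (hker : ∀ w, (∀ l, inner ℝ (v l) w = 0) → T w = 0) (k : Fin q) :
    ∃ K : ℝ, 0 < K ∧ ∀ (S : H →L[ℝ] H) (lam' : Fin q → ℝ) (v' : Fin q → H), IsSymmFiniteRank S →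
      IsLeadingEigensystem S lam' v' →
      ‖spanProj v' {l | lam l = lam k} - spanProj v {l | lam l = lam k}‖ ≤ K * ‖S - T‖ := by
  -- The distance from `lam k` to the other eigenvalues and to `0`; indices with `lam l = lam k`
  -- contribute the distance to `0`.
  obtain ⟨g, hg, hgk, hgap⟩ : ∃ g : ℝ, 0 < g ∧ g ≤ |lam k| ∧
      ∀ l, lam l ≠ lam k → g ≤ |lam l - lam k| := by
    have : Nonempty (Fin q) := ⟨k⟩
    obtain ⟨l₀, hl₀⟩ := Finite.exists_min
      fun l => if lam l = lam k then |lam k| else |lam l - lam k|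
    refine ⟨_, ?_, (hl₀ k).trans (by simp), fun l hl => (hl₀ l).trans (by simp [hl])⟩
    split_ifs with h0
    · exact abs_pos.2 (hpos k).ne'
    · exact abs_pos.2 (sub_ne_zero.2 h0)
  have hq : (1 : ℝ) ≤ q := by exact_mod_cast k.pos
  -- The constant is `2 * (q * δ)` with `δ = q * (2 * ε / g)`, divided by `ε`. For `ε > g / 2` it
  -- already exceeds the trivial bound `2` on the difference of two projections.
  refine ⟨4 * q ^ 2 / g, by positivity, fun S lam' v' hS h' => ?_⟩
  set I : Finset (Fin q) := {l | lam l = lam k} with hI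
  set ε := ‖S - T‖ with hε
  have hε0 : 0 ≤ ε := norm_nonneg _
  rcases lt_or_ge (g / 2) ε with hlarge | hsmall
  · have h1 : ‖spanProj v' I - spanProj v I‖ ≤ 2 :=
      (norm_sub_le _ _).trans (by linarith [norm_spanProj_le v' I, norm_spanProj_le v I])
    refine h1.trans ?_
    rw [div_mul_eq_mul_div, le_div_iff₀ hg]
    nlinarith [mul_le_mul_of_nonneg_right (one_le_pow₀ hq (n := 2)) hε0]
  -- Weyl in both directions puts `lam' l` within `g / 2` of `lam k`, and `v' l` is an approximate
  -- eigenvector of `T` at `lam' l` with defect at most `ε`.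
  · have hbound : ∀ l ∈ I, (1 - ∑ m ∈ I, inner ℝ (v m) (v' l) ^ 2) ≤ (2 * ε / g) ^ 2 := by
      intro l hl
      have hlk : lam l = lam k := (Finset.mem_filter.1 hl).2
      have hν : |lam' l - lam k| ≤ g / 2 := by
        rw [← hlk, abs_le]
        have h1 := h.eigenvalue_le_add hT h' l
        have h2 := h'.eigenvalue_le_add hS h l
        rw [norm_sub_rev] at h2
        constructor <;> linarith
      have h1 := gap_sq_mul_le hT.1 h.orthonormal h.eigen hker hg.le hgk hgap hν (v' l)
      have h2 : ‖T (v' l) - lam' l • v' l‖ ≤ ε := by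
        rw [← h'.eigen, ← norm_neg, neg_sub, ← sub_apply]
        simpa [h'.orthonormal.1 l] using (S - T).le_opNorm (v' l)
      rw [h'.orthonormal.1 l, one_pow] at h1
      have h3 := h1.trans (pow_le_pow_left₀ (norm_nonneg _) h2 2)
      rw [div_pow, le_div_iff₀ (by positivity)]
      linarith
    have hsum : ∑ l ∈ I, (1 - ∑ m ∈ I, inner ℝ (v m) (v' l) ^ 2) ≤ q * (2 * ε / g) ^ 2 := by
      refine (Finset.sum_le_sum hbound).trans ?_
      rw [Finset.sum_const, nsmul_eq_mul]
      gcongr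
      simpa using Finset.card_le_univ I
    -- Both spans use the same index set, so the total defect is symmetric. This bounds the defect
    -- of the `v l` without any gap in the spectrum of `S`.
    have hsymm : ∑ l ∈ I, (1 - ∑ m ∈ I, inner ℝ (v m) (v' l) ^ 2)
        = ∑ l ∈ I, (1 - ∑ m ∈ I, inner ℝ (v' m) (v l) ^ 2) := by
      rw [Finset.sum_sub_distrib, Finset.sum_sub_distrib, Finset.sum_comm]
      simp_rw [real_inner_comm]
    -- Since `q ≥ 1`, the factor `√q` may be replaced by `q`.
    have hδ : ∀ {x : ℝ}, 0 ≤ x → x ^ 2 ≤ q * (2 * ε / g) ^ 2 → x ≤ q * (2 * ε / g) := by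
      intro x hx hxs
      refine le_of_sq_le_sq (hxs.trans ?_) (by positivity)
      rw [mul_pow]
      refine mul_le_mul_of_nonneg_right ?_ (sq_nonneg _)
      nlinarith
    have hmem : ∀ {u w : Fin q → H}, Orthonormal ℝ u → Orthonormal ℝ w →
        ∑ l ∈ I, (1 - ∑ m ∈ I, inner ℝ (w m) (u l) ^ 2) ≤ q * (2 * ε / g) ^ 2 →
        ∀ l ∈ I, ‖u l - spanProj w I (u l)‖ ≤ q * (2 * ε / g) := by
      intro u w hu hw hle l hl
      refine hδ (norm_nonneg _) (le_trans ?_ hle)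
      have heq : ∀ l, (1 - ∑ m ∈ I, inner ℝ (w m) (u l) ^ 2)
          = ‖u l - spanProj w I (u l)‖ ^ 2 := fun l => by
        rw [norm_sub_spanProj_sq hw, hu.1 l, one_pow]
      simp_rw [heq]
      exact Finset.single_le_sum (f := fun l => ‖u l - spanProj w I (u l)‖ ^ 2)
        (fun _ _ => sq_nonneg _) hl
    refine (norm_spanProj_sub_spanProj_le h.orthonormal h'.orthonormal I (by positivity)
      (hmem h'.orthonormal h.orthonormal hsum)
      (hmem h.orthonormal h'.orthonormal (hsymm ▸ hsum))).trans (le_of_eq ?_)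
    ring

/-! ### The population operator and the deviation subspace. -/

theorem inner_delta_apply {k : ℕ} (c : Fin k → ℝ) (mu : Fin k → H) (w : H) :
    inner ℝ (delta c mu w) w
      = 1 / 2 * ∑ i, ∑ j, c i * c j * inner ℝ (mu i - mu j) w ^ 2 := by
  simp only [delta, smul_apply, sum_apply, tensor_apply,
    inner_smul_left, sum_inner]
  simp only [conj_trivial, sq]

theorem delta_apply_mem {k : ℕ} (c : Fin k → ℝ) (mu : Fin k → H) (w : H) :
    delta c mu w ∈ deviationSubspace mu := by
  simp only [delta, smul_apply, sum_apply, tensor_apply]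
  exact Submodule.smul_mem _ _ (Submodule.sum_mem _ fun i _ => Submodule.sum_mem _ fun j _ =>
    Submodule.smul_mem _ _ (Submodule.smul_mem _ _ (Submodule.subset_span ⟨(i, j), rfl⟩)))

theorem mem_deviationSubspace_orthogonal {k : ℕ} (mu : Fin k → H) (w : H) :
    w ∈ (deviationSubspace mu)ᗮ ↔ ∀ i j, inner ℝ (mu i - mu j) w = 0 := by
  rw [Submodule.mem_orthogonal]
  refine ⟨fun h i j => h _ (Submodule.subset_span ⟨(i, j), rfl⟩), fun h u hu => ?_⟩
  induction hu using Submodule.span_induction with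
  | mem u hu => obtain ⟨p, rfl⟩ := hu; exact h _ _
  | zero => simp
  | add a b _ _ ha hb => simp [inner_add_left, ha, hb]
  | smul a b _ hb => simp [inner_smul_left, hb]

theorem delta_apply_eq_zero {k : ℕ} (c : Fin k → ℝ) {mu : Fin k → H} {w : H}
    (hw : w ∈ (deviationSubspace mu)ᗮ) : delta c mu w = 0 := by
  rw [mem_deviationSubspace_orthogonal] at hw
  simp [delta, tensor_apply, hw]

/-- The form of `delta` is a sum of squares with positive weights, so if it is nonpositive at `w`
every square vanishes. With this, sign information on eigenvalues becomes information on subspaces.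
-/
theorem mem_orthogonal_of_inner_delta_nonpos {k : ℕ} {c : Fin k → ℝ} (hc : ∀ j, 0 < c j)
    {mu : Fin k → H} {w : H} (hw : inner ℝ (delta c mu w) w ≤ 0) :
    w ∈ (deviationSubspace mu)ᗮ := by
  rw [mem_deviationSubspace_orthogonal]
  rw [inner_delta_apply] at hw
  have hn : ∀ i j, 0 ≤ c i * c j * inner ℝ (mu i - mu j) w ^ 2 := fun i j =>
    mul_nonneg (mul_pos (hc i) (hc j)).le (sq_nonneg _)
  have h0 : ∑ i, ∑ j, c i * c j * inner ℝ (mu i - mu j) w ^ 2 = 0 :=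
    le_antisymm (by linarith) (Finset.sum_nonneg fun i _ => Finset.sum_nonneg fun j _ => hn i j)
  intro i j
  have h1 := (Finset.sum_eq_zero_iff_of_nonneg
    fun i _ => Finset.sum_nonneg fun j _ => hn i j).1 h0 i (Finset.mem_univ _)
  have h2 := (Finset.sum_eq_zero_iff_of_nonneg fun j _ => hn i j).1 h1 j (Finset.mem_univ _)
  have h3 := (mul_pos (hc i) (hc j)).ne'
  simpa [h3] using h2

instance finiteDimensional_deviationSubspace {k : ℕ} (mu : Fin k → H) : FiniteDimensional ℝ (deviationSubspace mu) :=
  FiniteDimensional.span_of_finite ℝ (Set.finite_range _)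

/-- The leading `q_d` eigenvalues of the population operator are positive, and it vanishes on the
orthogonal complement of the corresponding eigenvectors. -/
theorem IsLeadingEigensystem.delta_pos_and_ker {k : ℕ} {c : Fin k → ℝ} (hc : ∀ j, 0 < c j)
    {mu : Fin k → H} {lam : Fin (structuralDim mu) → ℝ} {v : Fin (structuralDim mu) → H}
    (h : IsLeadingEigensystem (delta c mu) lam v) :
    (∀ l, 0 < lam l) ∧ ∀ w, (∀ l, inner ℝ (v l) w = 0) → delta c mu w = 0 := by
  have hfr : Module.finrank ℝ (Submodule.span ℝ (Set.range v)) = structuralDim mu := by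
    rw [finrank_span_eq_card h.orthonormal.linearIndependent, Fintype.card_fin]
  have hfin : FiniteDimensional ℝ (Submodule.span ℝ (Set.range v)) :=
    FiniteDimensional.span_of_finite ℝ (Set.finite_range _)
  have hspan : ∀ w, w ∈ (Submodule.span ℝ (Set.range v))ᗮ → ∀ l, inner ℝ (v l) w = 0 :=
    fun w hw l => (Submodule.mem_orthogonal _ _).1 hw _ (Submodule.subset_span ⟨l, rfl⟩)
  have hpos : ∀ l, 0 < lam l := by
    by_contra hcon
    push Not at hcon
    obtain ⟨l, hl⟩ := hcon
    -- If `lam l ≤ 0`, the form is nonpositive off the span of the `v`, so that span contains the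
    -- deviation subspace and equals it by dimension. But `v l` also has nonpositive form, hence is
    -- orthogonal to that subspace: a unit vector orthogonal to itself.
    have hle : (Submodule.span ℝ (Set.range v))ᗮ ≤ (deviationSubspace mu)ᗮ := by
      intro w hw
      refine mem_orthogonal_of_inner_delta_nonpos hc ?_
      refine (h.inner_apply_le_of_orthogonal (isSymmFiniteRank_delta c mu) l (hspan w hw)).trans ?_
      exact mul_nonpos_of_nonpos_of_nonneg hl (sq_nonneg _)
    have hle' : deviationSubspace mu ≤ Submodule.span ℝ (Set.range v) := by
      have := Submodule.orthogonal_le hle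
      rwa [Submodule.orthogonal_orthogonal, Submodule.orthogonal_orthogonal] at this
    have heq := Submodule.eq_of_le_of_finrank_eq hle' hfr.symm
    have hvl : v l ∈ deviationSubspace mu := heq ▸ Submodule.subset_span ⟨l, rfl⟩
    have hvl' : v l ∈ (deviationSubspace mu)ᗮ := by
      refine mem_orthogonal_of_inner_delta_nonpos hc ?_
      rw [h.eigen, inner_smul_left, real_inner_self_eq_norm_sq]
      exact mul_nonpos_of_nonpos_of_nonneg (by simpa using hl) (sq_nonneg _)
    have h0 := (Submodule.mem_orthogonal _ _).1 hvl' _ hvl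
    rw [real_inner_self_eq_norm_sq, h.orthonormal.1 l] at h0
    simp at h0
  refine ⟨hpos, fun w hw => delta_apply_eq_zero c ?_⟩
  -- Eigenvectors for nonzero eigenvalues lie in the range; equality of dimensions then identifies
  -- the two subspaces.
  have hle : Submodule.span ℝ (Set.range v) ≤ deviationSubspace mu := by
    rw [Submodule.span_le]
    rintro _ ⟨l, rfl⟩
    have : v l = (lam l)⁻¹ • delta c mu (v l) := by
      rw [h.eigen, smul_smul, inv_mul_cancel₀ (hpos l).ne', one_smul]
    rw [this]
    exact Submodule.smul_mem _ _ (delta_apply_mem c mu _)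
  rw [← Submodule.eq_of_le_of_finrank_eq hle hfr, Submodule.mem_orthogonal]
  intro u hu
  induction hu using Submodule.span_induction with
  | mem u hu => obtain ⟨j, rfl⟩ := hu; exact hw j
  | zero => simp
  | add a b _ _ ha hb => simp [inner_add_left, ha, hb]
  | smul a b _ hb => simp [inner_smul_left, hb]

end Spectral

end CKPCA

noncomputable section

namespace CKPCA

/-! ### Algebra of centred sums of squares for a general bilinear product. -/

section Bilinear

variable {H : Type*} [NormedAddCommGroup H] [InnerProductSpace ℝ H]
  {V : Type*} [NormedAddCommGroup V] [NormedSpace ℝ V]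

/-- The centred sum of squares of `y` over `S`, for a bilinear product `B`. -/
def bilinScatter (B : H →L[ℝ] H →L[ℝ] V) (S : Finset ℕ) (y : ℕ → H) : V :=
  ∑ i ∈ S, B (y i - avg S y) (y i - avg S y)

/-- The analogue of `deltaHat` for a bilinear product `B`. -/
def bilinDeltaHat (B : H →L[ℝ] H →L[ℝ] V) (n a : ℕ) (y : ℕ → H) : V :=
  (n : ℝ)⁻¹ • bilinScatter B (Finset.range n) y -
    ((n / a : ℕ) : ℝ)⁻¹ • ∑ m ∈ Finset.range (n / a),
      (((segment n a m).card : ℝ) - 1)⁻¹ • bilinScatter B (segment n a m) y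

/-- The analogue of `delta` for a bilinear product `B`. -/
def bilinDelta (B : H →L[ℝ] H →L[ℝ] V) {k : ℕ} (c : Fin k → ℝ) (mu : Fin k → H) : V :=
  (1 / 2 : ℝ) • ∑ i, ∑ j, (c i * c j) • B (mu i - mu j) (mu i - mu j)

variable (B : H →L[ℝ] H →L[ℝ] V)

theorem bilinScatter_eq (S : Finset ℕ) (y : ℕ → H) :
    bilinScatter B S y
      = ∑ i ∈ S, B (y i) (y i) - (S.card : ℝ)⁻¹ • B (∑ i ∈ S, y i) (∑ i ∈ S, y i) := by
  rcases S.eq_empty_or_nonempty with rfl | hS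
  · simp [bilinScatter]
  have hk : (S.card : ℝ) ≠ 0 := by exact_mod_cast hS.card_pos.ne'
  have h1 : ∀ a : H, ∑ i ∈ S, B (y i) a = B (∑ i ∈ S, y i) a := fun a => by
    simp [map_sum]
  have h2 : ∀ a : H, ∑ i ∈ S, B a (y i) = B a (∑ i ∈ S, y i) := fun a => by
    simp [map_sum]
  simp only [bilinScatter, map_sub, sub_apply, Finset.sum_sub_distrib, h1, h2, Finset.sum_const]
  simp only [avg, map_smul, smul_apply, ← Nat.cast_smul_eq_nsmul ℝ]
  rw [smul_inv_smul₀ hk]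
  abel

/-- In this form the average has disappeared: vanishing on constant data and the norm bound are
immediate, and the double sum matches that of `bilinDelta`. -/
theorem bilinScatter_eq_sum_sum (S : Finset ℕ) (y : ℕ → H) :
    bilinScatter B S y
      = (2 * S.card : ℝ)⁻¹ • ∑ i ∈ S, ∑ l ∈ S, B (y i - y l) (y i - y l) := by
  rcases S.eq_empty_or_nonempty with rfl | hS
  · simp [bilinScatter]
  have hk : (S.card : ℝ) ≠ 0 := by exact_mod_cast hS.card_pos.ne'
  have h1 : ∑ i ∈ S, ∑ l ∈ S, B (y i) (y l) = B (∑ i ∈ S, y i) (∑ i ∈ S, y i) := by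
    simp [map_sum]
    exact Finset.sum_comm
  have h2 : ∑ i ∈ S, ∑ l ∈ S, B (y l) (y i) = B (∑ i ∈ S, y i) (∑ i ∈ S, y i) := by
    rw [Finset.sum_comm, h1]
  rw [bilinScatter_eq]
  simp only [map_sub, sub_apply, Finset.sum_sub_distrib, h1, h2, Finset.sum_const]
  simp only [← Nat.cast_smul_eq_nsmul ℝ, ← Finset.smul_sum]
  rw [mul_inv]
  match_scalars
  · field_simp
    norm_num
  · field_simp
    norm_num

theorem bilinScatter_eq_zero {S : Finset ℕ} {y : ℕ → H}
    (h : ∀ i ∈ S, ∀ l ∈ S, y i = y l) : bilinScatter B S y = 0 := by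
  rw [bilinScatter_eq_sum_sum, Finset.sum_eq_zero, smul_zero]
  intro i hi
  refine Finset.sum_eq_zero fun l hl => ?_
  rw [h i hi l hl, sub_self, map_zero]

variable {B}

theorem norm_bilinScatter_le (hB : ∀ f g, ‖B f g‖ ≤ ‖f‖ * ‖g‖) {S : Finset ℕ} {y : ℕ → H} {R : ℝ}
    (hy : ∀ i ∈ S, ‖y i‖ ≤ R) : ‖bilinScatter B S y‖ ≤ 2 * R ^ 2 * S.card := by
  rcases S.eq_empty_or_nonempty with rfl | hS
  · simp [bilinScatter]
  have hk : (0 : ℝ) < S.card := by exact_mod_cast hS.card_pos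
  rw [bilinScatter_eq_sum_sum, norm_smul, Real.norm_of_nonneg (by positivity)]
  have h1 : ‖∑ i ∈ S, ∑ l ∈ S, B (y i - y l) (y i - y l)‖
      ≤ ∑ i ∈ S, ∑ l ∈ S, (2 * R) ^ 2 := by
    refine norm_sum_le_of_le _ fun i hi => norm_sum_le_of_le _ fun l hl => (hB _ _).trans ?_
    rw [← sq]
    refine pow_le_pow_left₀ (norm_nonneg _) ((norm_sub_le _ _).trans ?_) 2
    linarith [hy i hi, hy l hl]
  simp only [Finset.sum_const, nsmul_eq_mul] at h1
  refine (mul_le_mul_of_nonneg_left h1 (by positivity)).trans (le_of_eq ?_)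
  field_simp

end Bilinear

/-! ### Hilbert–Schmidt operators as square summable families. -/

section HilbertSchmidt

variable {H : Type*} [NormedAddCommGroup H] [InnerProductSpace ℝ H] {ι : Type*}

theorem memlp_hsTensor (b : HilbertBasis ι ℝ H) (f g : H) :
    Memℓp (fun i => inner ℝ g (b i) • f) 2 := by
  refine memℓp_gen ?_
  have h := (b.summable_inner_mul_inner g g).mul_right (‖f‖ ^ 2)
  refine h.congr fun i => ?_
  rw [real_inner_comm g (b i), ENNReal.toReal_ofNat, norm_smul, Real.rpow_ofNat, mul_pow,
    Real.norm_eq_abs, sq_abs, sq (inner ℝ g (b i))]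

/-- The operator `f ⊗ g`, as the family of its values on a Hilbert basis. -/
def hsTensorFun (b : HilbertBasis ι ℝ H) (f g : H) : lp (fun _ : ι => H) 2 :=
  ⟨fun i => inner ℝ g (b i) • f, memlp_hsTensor b f g⟩

theorem hsTensorFun_apply (b : HilbertBasis ι ℝ H) (f g : H) (i : ι) :
    hsTensorFun b f g i = inner ℝ g (b i) • f := rfl

theorem lp_two_norm_sq {E : ι → Type*} [∀ i, NormedAddCommGroup (E i)] (D : lp E 2) :
    ‖D‖ ^ 2 = ∑' i, ‖D i‖ ^ 2 := by
  have := lp.norm_rpow_eq_tsum (p := 2) (by simp) D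
  simpa [ENNReal.toReal_ofNat, Real.rpow_ofNat] using this

theorem lp_two_summable {E : ι → Type*} [∀ i, NormedAddCommGroup (E i)] (D : lp E 2) :
    Summable fun i => ‖D i‖ ^ 2 := by
  have := (lp.memℓp D).summable (by simp)
  simpa [ENNReal.toReal_ofNat, Real.rpow_ofNat] using this

theorem norm_hsTensorFun (b : HilbertBasis ι ℝ H) (f g : H) :
    ‖hsTensorFun b f g‖ = ‖f‖ * ‖g‖ := by
  rw [← sq_eq_sq₀ (norm_nonneg _) (by positivity), lp_two_norm_sq, mul_pow,
    ← real_inner_self_eq_norm_sq g, ← b.tsum_inner_mul_inner g g, mul_comm, ← tsum_mul_right]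
  refine tsum_congr fun i => ?_
  rw [hsTensorFun_apply, real_inner_comm g (b i), norm_smul, mul_pow,
    Real.norm_eq_abs, sq_abs, sq (inner ℝ g (b i))]

/-- `(f, g) ↦ f ⊗ g` as a continuous bilinear map into the Hilbert space of square summable
families indexed by a Hilbert basis. -/
def hsTensor (b : HilbertBasis ι ℝ H) : H →L[ℝ] H →L[ℝ] lp (fun _ : ι => H) 2 :=
  LinearMap.mkContinuous₂
    (LinearMap.mk₂ ℝ (hsTensorFun b)
      (fun f f' g => by ext i; simp [hsTensorFun_apply])
      (fun a f g => by ext i; simp [hsTensorFun_apply, smul_smul, mul_comm])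
      (fun f g g' => by ext i; simp [hsTensorFun_apply, inner_add_left, add_smul])
      (fun a f g => by ext i; simp [hsTensorFun_apply, inner_smul_left, smul_smul]))
    1 (fun f g => by simp [norm_hsTensorFun])

theorem hsTensor_apply (b : HilbertBasis ι ℝ H) (f g : H) :
    hsTensor b f g = hsTensorFun b f g := rfl

theorem norm_hsTensor_le (b : HilbertBasis ι ℝ H) (f g : H) :
    ‖hsTensor b f g‖ ≤ ‖f‖ * ‖g‖ := (norm_hsTensorFun b f g).le

/-- `D` lists the values of `T` on the Hilbert basis `b`. -/
def Represents (b : HilbertBasis ι ℝ H) (T : H →L[ℝ] H) (D : lp (fun _ : ι => H) 2) : Prop :=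
  ∀ i, T (b i) = D i

variable {b : HilbertBasis ι ℝ H}

theorem represents_tensor (f g : H) : Represents b (tensor f g) (hsTensor b f g) := fun i => by
  rw [tensor_apply, hsTensor_apply, hsTensorFun_apply]

theorem Represents.smul {T : H →L[ℝ] H} {D : lp (fun _ : ι => H) 2} (h : Represents b T D)
    (a : ℝ) : Represents b (a • T) (a • D) := fun i => by simp [h i]

theorem Represents.sub {S T : H →L[ℝ] H} {C D : lp (fun _ : ι => H) 2} (h : Represents b S C)
    (h' : Represents b T D) : Represents b (S - T) (C - D) := fun i => by simp [h i, h' i]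

theorem Represents.sum {κ : Type*} (s : Finset κ) {T : κ → H →L[ℝ] H}
    {D : κ → lp (fun _ : ι => H) 2} (h : ∀ j ∈ s, Represents b (T j) (D j)) :
    Represents b (∑ j ∈ s, T j) (∑ j ∈ s, D j) := fun i => by
  rw [sum_apply, lp.coeFn_sum, Finset.sum_apply]
  exact Finset.sum_congr rfl fun j hj => h j hj i

theorem represents_scatter (S : Finset ℕ) (y : ℕ → H) :
    Represents b (scatter S y) (bilinScatter (hsTensor b) S y) :=
  Represents.sum _ fun _ _ => represents_tensor _ _

theorem represents_deltaHat (n a : ℕ) (y : ℕ → H) :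
    Represents b (deltaHat n a y) (bilinDeltaHat (hsTensor b) n a y) :=
  ((represents_scatter _ _).smul _).sub
    ((Represents.sum _ fun _ _ => (represents_scatter _ _).smul _).smul _)

theorem represents_delta {k : ℕ} (c : Fin k → ℝ) (mu : Fin k → H) :
    Represents b (delta c mu) (bilinDelta (hsTensor b) c mu) :=
  (Represents.sum _ fun _ _ => Represents.sum _ fun _ _ => (represents_tensor _ _).smul _).smul _

theorem Represents.isHilbertSchmidt {T : H →L[ℝ] H} {D : lp (fun _ : ι => H) 2}
    (h : Represents b T D) : IsHilbertSchmidt b T :=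
  (lp_two_summable D).congr fun i => by rw [h i]

theorem Represents.hsNorm_eq {T : H →L[ℝ] H} {D : lp (fun _ : ι => H) 2}
    (h : Represents b T D) : hsNorm b T = ‖D‖ := by
  have : ∑' i, ‖T (b i)‖ ^ 2 = ‖D‖ ^ 2 := by
    rw [lp_two_norm_sq]
    exact tsum_congr fun i => by rw [h i]
  rw [hsNorm, this, Real.sqrt_sq (norm_nonneg _)]

/-- Pairing `D` with the family of `T x ⊗ x` gives `‖T x‖ ^ 2`, and Cauchy–Schwarz bounds it by `‖T
x‖ * ‖x‖ * ‖D‖`. -/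
theorem Represents.norm_le {T : H →L[ℝ] H} {D : lp (fun _ : ι => H) 2}
    (h : Represents b T D) : ‖T‖ ≤ ‖D‖ := by
  refine T.opNorm_le_bound (norm_nonneg _) fun x => ?_
  have h1 : inner ℝ (hsTensor b (T x) x) D = inner ℝ (T x) (T x) := by
    have h2 := ((b.hasSum_repr x).mapL T).mapL (innerSL ℝ (T x))
    refine (lp.hasSum_inner _ _).unique ?_
    rw [← innerSL_apply_apply ℝ (T x)]
    convert h2 using 2 with i
    rw [hsTensor_apply, hsTensorFun_apply, map_smul, map_smul, b.repr_apply_apply, inner_smul_left,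
      h i, real_inner_comm x (b i)]
    simp
  have h3 : ‖T x‖ ^ 2 ≤ ‖T x‖ * ‖x‖ * ‖D‖ := by
    rw [← real_inner_self_eq_norm_sq, ← h1]
    exact (real_inner_le_norm _ _).trans
      (mul_le_mul_of_nonneg_right (norm_hsTensor_le b _ _) (norm_nonneg _))
  rcases (norm_nonneg (T x)).eq_or_lt with h0 | h0
  · rw [← h0]; positivity
  · nlinarith

end HilbertSchmidt

end CKPCA

end

namespace CKPCA

/-! ### Second moments of bounded Hilbert space valued random variables. -/

section SecondMoment

variable {Ω : Type*} [MeasurableSpace Ω] {P : Measure Ω} [IsProbabilityMeasure P]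
  {E : Type*} [NormedAddCommGroup E] [InnerProductSpace ℝ E] [CompleteSpace E]

theorem memLp_top_inner {Z W : Ω → E} (hZ : MemLp Z ⊤ P) (hW : MemLp W ⊤ P) :
    MemLp (fun ω => inner ℝ (Z ω) (W ω)) ⊤ P :=
  (innerSL ℝ : E →L[ℝ] E →L[ℝ] ℝ).memLp_of_bilin ⊤ hZ hW

theorem integrable_norm_sq {Z : Ω → E} (hZ : MemLp Z ⊤ P) : Integrable (fun ω => ‖Z ω‖ ^ 2) P := by
  simpa using (memLp_top_inner hZ hZ).integrable le_top

theorem memLp_sub_const {Z : Ω → E} (hZ : MemLp Z ⊤ P) (a : E) :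
    MemLp (fun ω => Z ω - a) ⊤ P := hZ.sub (memLp_const a)

theorem integral_inner_sub_sub {Z W : Ω → E} (hZ : MemLp Z ⊤ P) (hW : MemLp W ⊤ P) (a b : E) :
    ∫ ω, inner ℝ (Z ω - a) (W ω - b) ∂P
      = ∫ ω, inner ℝ (Z ω) (W ω) ∂P - inner ℝ (∫ ω, Z ω ∂P) b - inner ℝ a (∫ ω, W ω ∂P)
        + inner ℝ a b := by
  have iZ := hZ.integrable le_top
  have iW := hW.integrable le_top
  have i1 : Integrable (fun ω => inner ℝ (Z ω) (W ω)) P := (memLp_top_inner hZ hW).integrable le_top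
  have i2 : Integrable (fun ω => inner ℝ (Z ω) b) P := iZ.inner_const b
  have i3 : Integrable (fun ω => inner ℝ a (W ω)) P := iW.const_inner a
  have h2 : ∫ ω, inner ℝ (Z ω) b ∂P = inner ℝ (∫ ω, Z ω ∂P) b := by
    simp_rw [real_inner_comm b]
    exact integral_inner iZ b
  have h3 : ∫ ω, inner ℝ a (W ω) ∂P = inner ℝ a (∫ ω, W ω ∂P) := integral_inner iW a
  have : ∀ ω, inner ℝ (Z ω - a) (W ω - b)
      = inner ℝ (Z ω) (W ω) - inner ℝ (Z ω) b - inner ℝ a (W ω) + inner ℝ a b := fun ω => by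
    simp only [inner_sub_left, inner_sub_right]; ring
  simp_rw [this]
  rw [integral_add (by fun_prop) (by fun_prop), integral_sub (by fun_prop) (by fun_prop),
    integral_sub i1 i2, h2, h3]
  simp

/-- The mean is the best constant approximation in mean square; a variance may therefore be bounded
with any convenient centre. -/
theorem integral_norm_sub_integral_sq_le {Z : Ω → E} (hZ : MemLp Z ⊤ P) (a : E) :
    ∫ ω, ‖Z ω - ∫ ω', Z ω' ∂P‖ ^ 2 ∂P ≤ ∫ ω, ‖Z ω - a‖ ^ 2 ∂P := by
  simp_rw [← real_inner_self_eq_norm_sq]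
  rw [integral_inner_sub_sub hZ hZ, integral_inner_sub_sub hZ hZ]
  have := real_inner_self_nonneg (F := E) (x := ∫ ω, Z ω ∂P - a)
  rw [inner_sub_left, inner_sub_right, inner_sub_right] at this
  linarith

/-- The variance of a sum of uncorrelated bounded Hilbert space valued random variables. -/
theorem integral_norm_sum_sub_sq {κ : Type*} (S : Finset κ) {Z : κ → Ω → E}
    (hZ : ∀ i ∈ S, MemLp (Z i) ⊤ P)
    (h : ∀ i ∈ S, ∀ l ∈ S, i ≠ l → ∫ ω, inner ℝ (Z i ω) (Z l ω) ∂P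
      = inner ℝ (∫ ω, Z i ω ∂P) (∫ ω, Z l ω ∂P)) :
    ∫ ω, ‖∑ i ∈ S, Z i ω - ∑ i ∈ S, ∫ ω', Z i ω' ∂P‖ ^ 2 ∂P
      = ∑ i ∈ S, ∫ ω, ‖Z i ω - ∫ ω', Z i ω' ∂P‖ ^ 2 ∂P := by
  classical
  simp_rw [← Finset.sum_sub_distrib, ← real_inner_self_eq_norm_sq, sum_inner, inner_sum]
  have hW : ∀ i ∈ S, MemLp (fun ω => Z i ω - ∫ ω', Z i ω' ∂P) ⊤ P := fun i hi =>
    memLp_sub_const (hZ i hi) _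
  have hint : ∀ i ∈ S, ∀ l ∈ S, Integrable (fun ω =>
      inner ℝ (Z i ω - ∫ ω', Z i ω' ∂P) (Z l ω - ∫ ω', Z l ω' ∂P)) P := fun i hi l hl =>
    (memLp_top_inner (hW i hi) (hW l hl)).integrable le_top
  rw [integral_finsetSum _ fun i hi => integrable_finsetSum _ fun l hl => hint i hi l hl]
  refine Finset.sum_congr rfl fun i hi => ?_
  rw [integral_finsetSum _ fun l hl => hint i hi l hl, Finset.sum_eq_single_of_mem i hi]
  intro l hl hli
  rw [integral_inner_sub_sub (hZ i hi) (hZ l hl), h i hi l hl hli.symm]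
  ring

theorem integral_norm_sum_sub_sq_le {κ : Type*} (S : Finset κ) {Z : κ → Ω → E} {K : ℝ}
    (hZ : ∀ i ∈ S, MemLp (Z i) ⊤ P) (hK : ∀ i ∈ S, ∀ᵐ ω ∂P, ‖Z i ω‖ ^ 2 ≤ K)
    (h : ∀ i ∈ S, ∀ l ∈ S, i ≠ l → ∫ ω, inner ℝ (Z i ω) (Z l ω) ∂P
      = inner ℝ (∫ ω, Z i ω ∂P) (∫ ω, Z l ω ∂P)) :
    ∫ ω, ‖∑ i ∈ S, Z i ω - ∑ i ∈ S, ∫ ω', Z i ω' ∂P‖ ^ 2 ∂P ≤ S.card * K := by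
  rw [integral_norm_sum_sub_sq S hZ h, ← nsmul_eq_mul]
  refine Finset.sum_le_card_nsmul _ _ _ fun i hi => ?_
  refine (integral_norm_sub_integral_sq_le (hZ i hi) 0).trans ?_
  simp only [sub_zero]
  refine (integral_mono_ae (integrable_norm_sq (hZ i hi)) (integrable_const K) (hK i hi)).trans ?_
  simp

end SecondMoment

/-- Independent random elements `X 0, …, X (n-1)` whose features are bounded by `R`. -/
structure BoundedSample {Ω : Type*} [MeasurableSpace Ω] (P : Measure Ω) {𝒳 : Type*}
    [MeasurableSpace 𝒳] {H : Type*} [NormedAddCommGroup H] (Φ : 𝒳 → H) (X : ℕ → Ω → 𝒳)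
    (n : ℕ) (R : ℝ) : Prop where
  meas : StronglyMeasurable Φ
  aem : ∀ i < n, AEMeasurable (X i) P
  indep : iIndepFun (fun i : Fin n => X i) P
  nonneg : 0 ≤ R
  bound : ∀ i < n, ∀ᵐ ω ∂P, ‖Φ (X i ω)‖ ≤ R

/-! ### Mean, variance and decorrelation of centred sums of squares. -/

section Sample

variable {Ω : Type*} [MeasurableSpace Ω] {P : Measure Ω} [IsProbabilityMeasure P]
  {𝒳 : Type*} [MeasurableSpace 𝒳]
  {H : Type*} [NormedAddCommGroup H] [InnerProductSpace ℝ H] [CompleteSpace H]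
  {V : Type*} [NormedAddCommGroup V] [InnerProductSpace ℝ V] [CompleteSpace V]
  {Φ : 𝒳 → H} {X : ℕ → Ω → 𝒳} {n : ℕ} {R : ℝ}

theorem BoundedSample.memLp (h : BoundedSample P Φ X n R) {i : ℕ} (hi : i < n) :
    MemLp (fun ω => Φ (X i ω)) ⊤ P :=
  memLp_top_of_bound (h.meas.aestronglyMeasurable.comp_aemeasurable (h.aem i hi)) R (h.bound i hi)

theorem BoundedSample.norm_integral_le (h : BoundedSample P Φ X n R) {i : ℕ} (hi : i < n) :
    ‖∫ ω, Φ (X i ω) ∂P‖ ≤ R := by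
  simpa using norm_integral_le_of_norm_le_const (h.bound i hi)

/-- Independence in bilinear form: `L = B` computes expectations of cross terms, `L = innerSL ℝ`
shows that summands are uncorrelated. -/
theorem BoundedSample.integral_bilin_comp {E F G : Type*} [NormedAddCommGroup E] [NormedSpace ℝ E]
    [CompleteSpace E] [NormedAddCommGroup F] [NormedSpace ℝ F] [CompleteSpace F]
    [NormedAddCommGroup G] [NormedSpace ℝ G] [CompleteSpace G]
    (h : BoundedSample P Φ X n R) {i l : ℕ} (hi : i < n) (hl : l < n) (hil : i ≠ l)
    {f : 𝒳 → E} {g : 𝒳 → F} (hf : StronglyMeasurable f) (hg : StronglyMeasurable g)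
    (hfi : Integrable (fun ω => f (X i ω)) P) (hgl : Integrable (fun ω => g (X l ω)) P)
    (L : E →L[ℝ] F →L[ℝ] G) :
    ∫ ω, L (f (X i ω)) (g (X l ω)) ∂P = L (∫ ω, f (X i ω) ∂P) (∫ ω, g (X l ω) ∂P) := by
  have hind : IndepFun (X i) (X l) P :=
    h.indep.indepFun (i := ⟨i, hi⟩) (j := ⟨l, hl⟩) (by simpa using hil)
  exact hind.integral_bilin_comp_comp (h.aem i hi) (h.aem l hl)
    ((integrable_map_measure hf.aestronglyMeasurable (h.aem i hi)).2 hfi)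
    ((integrable_map_measure hg.aestronglyMeasurable (h.aem l hl)).2 hgl) L

variable (B : H →L[ℝ] H →L[ℝ] V)

/-- The covariance `E B(Φ(X i), Φ(X i)) - B(E Φ(X i), E Φ(X i))` for a bilinear product `B`. -/
noncomputable def bilinCov (P : Measure Ω) (Φ : 𝒳 → H) (X : ℕ → Ω → 𝒳) (i : ℕ) : V :=
  ∫ ω, B (Φ (X i ω)) (Φ (X i ω)) ∂P - B (∫ ω, Φ (X i ω) ∂P) (∫ ω, Φ (X i ω) ∂P)

variable {B}

theorem BoundedSample.memLp_bilin (h : BoundedSample P Φ X n R) {i l : ℕ} (hi : i < n)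
    (hl : l < n) : MemLp (fun ω => B (Φ (X i ω)) (Φ (X l ω))) ⊤ P :=
  B.memLp_of_bilin ⊤ (h.memLp hi) (h.memLp hl)

theorem BoundedSample.norm_bilin_le (h : BoundedSample P Φ X n R)
    (hB : ∀ f g, ‖B f g‖ ≤ ‖f‖ * ‖g‖) {i : ℕ} (hi : i < n) :
    ∀ᵐ ω ∂P, ‖B (Φ (X i ω)) (Φ (X i ω))‖ ≤ R ^ 2 := by
  filter_upwards [h.bound i hi] with ω hω
  refine (hB _ _).trans ?_
  rw [← sq]
  exact pow_le_pow_left₀ (norm_nonneg _) hω 2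

theorem BoundedSample.norm_bilinCov_le (h : BoundedSample P Φ X n R)
    (hB : ∀ f g, ‖B f g‖ ≤ ‖f‖ * ‖g‖) {i : ℕ} (hi : i < n) :
    ‖bilinCov B P Φ X i‖ ≤ 2 * R ^ 2 := by
  have h1 : ‖∫ ω, B (Φ (X i ω)) (Φ (X i ω)) ∂P‖ ≤ R ^ 2 := by
    simpa using norm_integral_le_of_norm_le_const (h.norm_bilin_le hB hi)
  have h2 := (hB (∫ ω, Φ (X i ω) ∂P) (∫ ω, Φ (X i ω) ∂P)).trans
    (mul_le_mul (h.norm_integral_le hi) (h.norm_integral_le hi) (norm_nonneg _) h.nonneg)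
  refine (norm_sub_le _ _).trans ?_
  linarith [sq R]

theorem BoundedSample.memLp_bilinScatter (h : BoundedSample P Φ X n R) {S : Finset ℕ}
    (hS : ∀ i ∈ S, i < n) : MemLp (fun ω => bilinScatter B S fun i => Φ (X i ω)) ⊤ P := by
  have hs : MemLp (fun ω => ∑ i ∈ S, Φ (X i ω)) ⊤ P :=
    memLp_finsetSum S fun i hi => h.memLp (hS i hi)
  have hs' : MemLp (fun ω => B (∑ i ∈ S, Φ (X i ω)) (∑ i ∈ S, Φ (X i ω))) ⊤ P :=
    B.memLp_of_bilin ⊤ hs hs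
  have hd : MemLp (fun ω => ∑ i ∈ S, B (Φ (X i ω)) (Φ (X i ω))) ⊤ P :=
    memLp_finsetSum S fun i hi => h.memLp_bilin (hS i hi) (hS i hi)
  have heq : (fun ω => bilinScatter B S fun i => Φ (X i ω))
      = (fun ω => ∑ i ∈ S, B (Φ (X i ω)) (Φ (X i ω)))
        - (S.card : ℝ)⁻¹ • fun ω => B (∑ i ∈ S, Φ (X i ω)) (∑ i ∈ S, Φ (X i ω)) := by
    funext ω
    exact bilinScatter_eq B S _
  rw [heq]
  exact hd.sub (hs'.const_smul _)

/-- The expectation of the centred sum of squares. -/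
theorem BoundedSample.integral_bilinScatter (h : BoundedSample P Φ X n R) {S : Finset ℕ}
    (hS : ∀ i ∈ S, i < n) :
    ∫ ω, bilinScatter B S (fun i => Φ (X i ω)) ∂P
      = (1 - (S.card : ℝ)⁻¹) • ∑ i ∈ S, bilinCov B P Φ X i
        + bilinScatter B S fun i => ∫ ω, Φ (X i ω) ∂P := by
  classical
  have hint : ∀ i ∈ S, ∀ l ∈ S, Integrable (fun ω => B (Φ (X i ω)) (Φ (X l ω))) P :=
    fun i hi l hl => (h.memLp_bilin (hS i hi) (hS l hl)).integrable le_top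
  have hBss : ∀ y : ℕ → H, B (∑ i ∈ S, y i) (∑ i ∈ S, y i) = ∑ i ∈ S, ∑ l ∈ S, B (y i) (y l) := by
    intro y
    simp [map_sum]
    exact Finset.sum_comm
  -- Only the diagonal carries a covariance. It enters the sum of squares with weight `1` and the
  -- product of sums with weight `1 / |S|`, hence the factor `1 - 1 / |S|`.
  have hcross : ∀ i ∈ S, ∀ l ∈ S, ∫ ω, B (Φ (X i ω)) (Φ (X l ω)) ∂P
      = B (∫ ω, Φ (X i ω) ∂P) (∫ ω, Φ (X l ω) ∂P) + if i = l then bilinCov B P Φ X i else 0 := by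
    intro i hi l hl
    split_ifs with hil
    · subst hil
      simp [bilinCov]
    · rw [h.integral_bilin_comp (hS i hi) (hS l hl) hil h.meas h.meas
        ((h.memLp (hS i hi)).integrable le_top) ((h.memLp (hS l hl)).integrable le_top), add_zero]
  simp_rw [bilinScatter_eq, hBss]
  have i1 : Integrable (fun ω => ∑ i ∈ S, B (Φ (X i ω)) (Φ (X i ω))) P :=
    integrable_finsetSum _ fun i hi => hint i hi i hi
  have i2 : Integrable (fun ω => ∑ i ∈ S, ∑ l ∈ S, B (Φ (X i ω)) (Φ (X l ω))) P :=
    integrable_finsetSum _ fun i hi => integrable_finsetSum _ fun l hl => hint i hi l hl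
  have i3 : Integrable
      (fun ω => (S.card : ℝ)⁻¹ • ∑ i ∈ S, ∑ l ∈ S, B (Φ (X i ω)) (Φ (X l ω))) P := i2.smul _
  rw [integral_sub i1 i3, integral_smul, integral_finsetSum _ fun i hi => hint i hi i hi,
    integral_finsetSum _ fun i hi => integrable_finsetSum _ fun l hl => hint i hi l hl]
  have h1 : ∑ i ∈ S, ∫ ω, ∑ l ∈ S, B (Φ (X i ω)) (Φ (X l ω)) ∂P
      = ∑ i ∈ S, ∑ l ∈ S, B (∫ ω, Φ (X i ω) ∂P) (∫ ω, Φ (X l ω) ∂P)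
        + ∑ i ∈ S, bilinCov B P Φ X i := by
    rw [← Finset.sum_add_distrib]
    refine Finset.sum_congr rfl fun i hi => ?_
    rw [integral_finsetSum _ fun l hl => hint i hi l hl, Finset.sum_congr rfl (hcross i hi),
      Finset.sum_add_distrib]
    simp [hi]
  have h2 : ∑ i ∈ S, ∫ ω, B (Φ (X i ω)) (Φ (X i ω)) ∂P
      = ∑ i ∈ S, B (∫ ω, Φ (X i ω) ∂P) (∫ ω, Φ (X i ω) ∂P) + ∑ i ∈ S, bilinCov B P Φ X i := by
    rw [← Finset.sum_add_distrib]
    exact Finset.sum_congr rfl fun i hi => by simp [bilinCov]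
  rw [h1, h2]
  module

theorem norm_bilin_self_sub_le (hB : ∀ f g, ‖B f g‖ ≤ ‖f‖ * ‖g‖) (x y : H) :
    ‖B x x - B y y‖ ≤ ‖x - y‖ * (‖x‖ + ‖y‖) := by
  have : B x x - B y y = B (x - y) x + B y (x - y) := by
    simp [map_sub]
  rw [this]
  refine (norm_add_le _ _).trans ((add_le_add (hB _ _) (hB _ _)).trans (le_of_eq ?_))
  ring

/-- The map `s ↦ |S|⁻¹ B s s` is `2 R`-Lipschitz on the ball of radius `|S| R`, which contains both
sums. The scatter is thus compared with two linear statistics; `(x + y) ^ 2 ≤ 2 x ^ 2 + 2 y ^ 2`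
yields the constants `2` and `8 R ^ 2`. -/
theorem norm_bilinScatter_sub_sq_le (hB : ∀ f g, ‖B f g‖ ≤ ‖f‖ * ‖g‖) {S : Finset ℕ}
    (hne : S.Nonempty) {y m : ℕ → H} {w : V} (hy : ∀ i ∈ S, ‖y i‖ ≤ R) (hm : ∀ i ∈ S, ‖m i‖ ≤ R) :
    ‖bilinScatter B S y - (w - (S.card : ℝ)⁻¹ • B (∑ i ∈ S, m i) (∑ i ∈ S, m i))‖ ^ 2
      ≤ 2 * ‖∑ i ∈ S, B (y i) (y i) - w‖ ^ 2
        + 8 * R ^ 2 * ‖∑ i ∈ S, y i - ∑ i ∈ S, m i‖ ^ 2 := by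
  have hk : (0 : ℝ) < S.card := by exact_mod_cast hne.card_pos
  have hsum : ∀ {y : ℕ → H}, (∀ i ∈ S, ‖y i‖ ≤ R) → ‖∑ i ∈ S, y i‖ ≤ S.card * R := by
    intro y hy
    simpa using norm_sum_le_of_le S hy
  rw [bilinScatter_eq]
  have hys := hsum hy
  have hms := hsum hm
  generalize ∑ i ∈ S, y i = s at *
  generalize ∑ i ∈ S, m i = t at *
  generalize ∑ i ∈ S, B (y i) (y i) = u at *
  have h1 : ‖(S.card : ℝ)⁻¹ • (B s s - B t t)‖ ≤ 2 * R * ‖s - t‖ := by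
    rw [norm_smul, norm_inv, Real.norm_natCast, inv_mul_le_iff₀ hk]
    refine (norm_bilin_self_sub_le hB _ _).trans ?_
    have := mul_le_mul_of_nonneg_left (add_le_add hys hms) (norm_nonneg (s - t))
    linarith
  have h2 : u - (S.card : ℝ)⁻¹ • B s s - (w - (S.card : ℝ)⁻¹ • B t t)
      = (u - w) - (S.card : ℝ)⁻¹ • (B s s - B t t) := by
    rw [smul_sub]
    abel
  rw [h2]
  have h3 := (norm_sub_le (u - w) ((S.card : ℝ)⁻¹ • (B s s - B t t))).trans
    (add_le_add_right h1 _)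
  refine (pow_le_pow_left₀ (norm_nonneg _) h3 2).trans ((add_sq_le (R := ℝ)).trans (le_of_eq ?_))
  ring

/-- The variance of the centred sum of squares grows at most linearly. -/
theorem BoundedSample.integral_norm_bilinScatter_sub_sq_le (h : BoundedSample P Φ X n R)
    (hB : ∀ f g, ‖B f g‖ ≤ ‖f‖ * ‖g‖) {S : Finset ℕ} (hS : ∀ i ∈ S, i < n) :
    ∫ ω, ‖bilinScatter B S (fun i => Φ (X i ω))
        - ∫ ω', bilinScatter B S (fun i => Φ (X i ω')) ∂P‖ ^ 2 ∂P ≤ 10 * R ^ 4 * S.card := by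
  rcases S.eq_empty_or_nonempty with rfl | hne
  · simp [bilinScatter]
  have b1 : ∫ ω, ‖∑ i ∈ S, B (Φ (X i ω)) (Φ (X i ω))
      - ∑ i ∈ S, ∫ ω', B (Φ (X i ω')) (Φ (X i ω')) ∂P‖ ^ 2 ∂P ≤ S.card * (R ^ 2) ^ 2 := by
    refine integral_norm_sum_sub_sq_le S (fun i hi => h.memLp_bilin (hS i hi) (hS i hi)) ?_ ?_
    · intro i hi
      filter_upwards [h.norm_bilin_le hB (hS i hi)] with ω hω
      exact pow_le_pow_left₀ (norm_nonneg _) hω 2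
    · intro i hi l hl hil
      have hg : StronglyMeasurable fun x => B (Φ x) (Φ x) :=
        B.continuous₂.comp_stronglyMeasurable (h.meas.prodMk h.meas)
      exact h.integral_bilin_comp (hS i hi) (hS l hl) hil hg hg
        ((h.memLp_bilin (hS i hi) (hS i hi)).integrable le_top)
        ((h.memLp_bilin (hS l hl) (hS l hl)).integrable le_top) (innerSL ℝ)
  have b2 : ∫ ω, ‖∑ i ∈ S, Φ (X i ω) - ∑ i ∈ S, ∫ ω', Φ (X i ω') ∂P‖ ^ 2 ∂P
      ≤ S.card * R ^ 2 := by
    refine integral_norm_sum_sub_sq_le S (fun i hi => h.memLp (hS i hi)) ?_ ?_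
    · intro i hi
      filter_upwards [h.bound i (hS i hi)] with ω hω
      exact pow_le_pow_left₀ (norm_nonneg _) hω 2
    · intro i hi l hl hil
      exact h.integral_bilin_comp (hS i hi) (hS l hl) hil h.meas h.meas
        ((h.memLp (hS i hi)).integrable le_top)
        ((h.memLp (hS l hl)).integrable le_top) (innerSL ℝ)
  have hall : ∀ᵐ ω ∂P, ∀ i ∈ S, ‖Φ (X i ω)‖ ≤ R :=
    (eventually_all_finset S).2 fun i hi => h.bound i (hS i hi)
  have hm : ∀ i ∈ S, ‖∫ ω, Φ (X i ω) ∂P‖ ≤ R := fun i hi => h.norm_integral_le (hS i hi)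
  have hM1 : MemLp (fun ω => ∑ i ∈ S, B (Φ (X i ω)) (Φ (X i ω))) ⊤ P :=
    memLp_finsetSum S fun i hi => h.memLp_bilin (hS i hi) (hS i hi)
  have hM2 : MemLp (fun ω => ∑ i ∈ S, Φ (X i ω)) ⊤ P :=
    memLp_finsetSum S fun i hi => h.memLp (hS i hi)
  have hi1 := integrable_norm_sq
    (memLp_sub_const hM1 (∑ i ∈ S, ∫ ω, B (Φ (X i ω)) (Φ (X i ω)) ∂P))
  have hi2 := integrable_norm_sq (memLp_sub_const hM2 (∑ i ∈ S, ∫ ω, Φ (X i ω) ∂P))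
  have hsc := h.memLp_bilinScatter (B := B) hS
  generalize ∑ i ∈ S, ∫ ω, B (Φ (X i ω)) (Φ (X i ω)) ∂P = w at *
  have hpt : ∀ᵐ ω ∂P, ‖bilinScatter B S (fun i => Φ (X i ω))
      - (w - (S.card : ℝ)⁻¹ • B (∑ i ∈ S, ∫ ω, Φ (X i ω) ∂P) (∑ i ∈ S, ∫ ω, Φ (X i ω) ∂P))‖ ^ 2
      ≤ 2 * ‖∑ i ∈ S, B (Φ (X i ω)) (Φ (X i ω)) - w‖ ^ 2
        + 8 * R ^ 2 * ‖∑ i ∈ S, Φ (X i ω) - ∑ i ∈ S, ∫ ω, Φ (X i ω) ∂P‖ ^ 2 := by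
    filter_upwards [hall] with ω hω
    exact norm_bilinScatter_sub_sq_le hB hne hω hm
  refine (integral_norm_sub_integral_sq_le hsc _).trans
    ((integral_mono_ae (integrable_norm_sq (memLp_sub_const hsc _))
      ((hi1.const_mul 2).add (hi2.const_mul (8 * R ^ 2))) hpt).trans ?_)
  rw [integral_add' (hi1.const_mul 2) (hi2.const_mul (8 * R ^ 2)), integral_const_mul,
    integral_const_mul]
  -- The two linear statistics contribute `2 R ^ 4` and `8 R ^ 4` per observation.
  refine (add_le_add (mul_le_mul_of_nonneg_left b1 zero_le_two)
    (mul_le_mul_of_nonneg_left b2 (by positivity))).trans (le_of_eq ?_)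
  ring

theorem bilinScatter_congr {S : Finset ℕ} {y y' : ℕ → H} (h : ∀ i ∈ S, y i = y' i) :
    bilinScatter B S y = bilinScatter B S y' := by
  rw [bilinScatter_eq, bilinScatter_eq, Finset.sum_congr rfl h,
    Finset.sum_congr rfl fun i hi => by rw [h i hi]]

/-- Centred sums of squares over disjoint blocks are uncorrelated. -/
theorem BoundedSample.integral_inner_bilinScatter (h : BoundedSample P Φ X n R) {S T : Finset ℕ}
    (hS : ∀ i ∈ S, i < n) (hT : ∀ i ∈ T, i < n) (hST : Disjoint S T) :
    ∫ ω, inner ℝ (bilinScatter B S fun i => Φ (X i ω)) (bilinScatter B T fun i => Φ (X i ω)) ∂P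
      = inner ℝ (∫ ω, bilinScatter B S (fun i => Φ (X i ω)) ∂P)
        (∫ ω, bilinScatter B T (fun i => Φ (X i ω)) ∂P) := by
  classical
  -- Independence is indexed by `Fin n`, so the blocks are pulled back there and each scatter is
  -- written as a function of its own tuple of observations.
  let S' : Finset ℕ → Finset (Fin n) := fun S => Finset.univ.filter fun i => (i : ℕ) ∈ S
  have hdisj : Disjoint (S' S) (S' T) := by
    rw [Finset.disjoint_left] at hST ⊢
    intro i hi hi'
    exact hST (Finset.mem_filter.1 hi).2 (Finset.mem_filter.1 hi').2
  have hind := h.indep.indepFun_finset₀ (S' S) (S' T) hdisj fun i => h.aem i i.2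
  -- The default value `0` is never seen by the scatter, which only reads indices in `S`.
  let G : ∀ S : Finset ℕ, (S' S → 𝒳) → ℕ → H := fun S x i =>
    if hi : ∃ hn : i < n, (⟨i, hn⟩ : Fin n) ∈ S' S then Φ (x ⟨⟨i, hi.1⟩, hi.2⟩) else 0
  have hG : ∀ S i, StronglyMeasurable fun x => G S x i := by
    intro S i
    by_cases hi : ∃ hn : i < n, (⟨i, hn⟩ : Fin n) ∈ S' S
    · simp only [G, dif_pos hi]
      exact h.meas.comp_measurable (measurable_pi_apply _)
    · simp only [G, dif_neg hi]
      exact stronglyMeasurable_const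
  have hF : ∀ S, StronglyMeasurable fun x => bilinScatter B S (G S x) := by
    intro S
    have hs : StronglyMeasurable fun x => ∑ i ∈ S, G S x i :=
      Finset.stronglyMeasurable_fun_sum S fun i _ => hG S i
    simp_rw [bilinScatter_eq]
    exact (Finset.stronglyMeasurable_fun_sum S fun i _ =>
      B.continuous₂.comp_stronglyMeasurable ((hG S i).prodMk (hG S i))).sub
        ((B.continuous₂.comp_stronglyMeasurable (hs.prodMk hs)).const_smul _)
  have hrep : ∀ S : Finset ℕ, (∀ i ∈ S, i < n) → ∀ ω,
      bilinScatter B S (G S fun i => X i ω) = bilinScatter B S fun i => Φ (X i ω) := by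
    intro S hS ω
    refine bilinScatter_congr fun i hi => ?_
    have : ∃ hn : i < n, (⟨i, hn⟩ : Fin n) ∈ S' S := ⟨hS i hi, by simpa [S'] using hi⟩
    simp only [G, dif_pos this]
  have haem : ∀ S, AEMeasurable (fun ω (i : S' S) => X i ω) P := fun S =>
    aemeasurable_pi_lambda _ fun i => h.aem _ i.1.2
  have hint : ∀ S : Finset ℕ, (∀ i ∈ S, i < n) →
      Integrable (fun x => bilinScatter B S (G S x)) (P.map fun ω (i : S' S) => X i ω) := by
    intro S hS
    refine (integrable_map_measure (hF S).aestronglyMeasurable (haem S)).2 ?_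
    refine ((h.memLp_bilinScatter (B := B) hS).integrable le_top).congr ?_
    exact Eventually.of_forall fun ω => (hrep S hS ω).symm
  have := hind.integral_bilin_comp_comp (haem S) (haem T) (hint S hS) (hint T hT) (innerSL ℝ)
  simp_rw [hrep S hS, hrep T hT] at this
  exact this

end Sample

end CKPCA

namespace CKPCA

/-! ### Combinatorics of the segments. -/

section Segment

variable {n a m : ℕ}

/-- Every time belongs to exactly one segment, whose index is explicit. -/
theorem segment_eq_filter (ha : 0 < a) (hm : m < n / a) :
    segment n a m = (Finset.range n).filter fun i => min (i / a) (n / a - 1) = m := by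
  have hr : n / a * a ≤ n := Nat.div_mul_le_self n a
  ext i
  simp only [segment, Finset.mem_Ico, Finset.mem_filter, Finset.mem_range]
  split_ifs with h
  · rw [← Nat.le_div_iff_mul_le ha]
    omega
  · have h1 : (m + 1) * a ≤ n := (Nat.mul_le_mul_right a hm).trans hr
    rw [← Nat.le_div_iff_mul_le ha, ← Nat.div_lt_iff_lt_mul ha]
    constructor
    · rintro ⟨h2, h3⟩
      have := (Nat.div_lt_iff_lt_mul ha).1 h3
      omega
    · rintro ⟨h2, h3⟩
      omega

theorem segment_lt (ha : 0 < a) (hm : m < n / a) {i : ℕ} (hi : i ∈ segment n a m) : i < n := by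
  rw [segment_eq_filter ha hm] at hi
  exact Finset.mem_range.1 (Finset.mem_filter.1 hi).1

theorem disjoint_segment (ha : 0 < a) (hm : m < n / a) {m' : ℕ} (hm' : m' < n / a)
    (hne : m ≠ m') : Disjoint (segment n a m) (segment n a m') := by
  rw [segment_eq_filter ha hm, segment_eq_filter ha hm', Finset.disjoint_left]
  intro i hi hi'
  exact hne ((Finset.mem_filter.1 hi).2.symm.trans (Finset.mem_filter.1 hi').2)

theorem sum_segment {M : Type*} [AddCommMonoid M] (ha : 0 < a) (han : a ≤ n) (f : ℕ → M) :
    ∑ m ∈ Finset.range (n / a), ∑ i ∈ segment n a m, f i = ∑ i ∈ Finset.range n, f i := by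
  have hpos : 0 < n / a := Nat.div_pos han ha
  rw [← Finset.sum_fiberwise_of_maps_to (s := Finset.range n) (t := Finset.range (n / a))
    (g := fun i => min (i / a) (n / a - 1)) (fun i _ => Finset.mem_range.2 (by omega))]
  exact Finset.sum_congr rfl fun m hm => by rw [segment_eq_filter ha (Finset.mem_range.1 hm)]

theorem le_card_segment (hm : m < n / a) : a ≤ (segment n a m).card := by
  have hr : n / a * a ≤ n := Nat.div_mul_le_self n a
  have h1 : (m + 1) * a ≤ n := (Nat.mul_le_mul_right a hm).trans hr
  rw [segment, Nat.card_Ico]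
  have h2 : (m + 1) * a = m * a + a := by ring
  split_ifs <;> omega

/-- The number of segments is at least `n / (2 a)`. -/
theorem inv_card_segments_le (ha : 0 < a) (han : a ≤ n) :
    ((n / a : ℕ) : ℝ)⁻¹ ≤ 2 * (a / n : ℝ) := by
  have hpos : 0 < n / a := Nat.div_pos han ha
  have hn : (0 : ℝ) < n := by exact_mod_cast ha.trans_le han
  have h1 : n < (n / a + 1) * a := by
    rw [mul_comm]
    exact Nat.lt_mul_div_succ n ha
  -- As `n / a ≥ 1`, one has `n / a + 1 ≤ 2 * (n / a)`.
  have h2 : n ≤ 2 * (n / a) * a := h1.le.trans (Nat.mul_le_mul_right a (by omega))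
  have h3 : (n : ℝ) ≤ 2 * ((n / a : ℕ) : ℝ) * a := by exact_mod_cast h2
  have hr : (0 : ℝ) < ((n / a : ℕ) : ℝ) := by exact_mod_cast hpos
  rw [inv_le_iff_one_le_mul₀ hr, ← mul_div_assoc, div_mul_eq_mul_div, le_div_iff₀ hn]
  linarith

end Segment

/-! ### Variance and bias of the corrected estimator. -/

section Variance

variable {Ω : Type*} [MeasurableSpace Ω] {P : Measure Ω} [IsProbabilityMeasure P]
  {𝒳 : Type*} [MeasurableSpace 𝒳]
  {H : Type*} [NormedAddCommGroup H] [InnerProductSpace ℝ H] [CompleteSpace H]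
  {V : Type*} [NormedAddCommGroup V] [InnerProductSpace ℝ V] [CompleteSpace V]
  {Φ : 𝒳 → H} {X : ℕ → Ω → 𝒳} {n a : ℕ} {R : ℝ} {B : H →L[ℝ] H →L[ℝ] V}

theorem integral_norm_smul_sub_sq (t : ℝ) (Z : Ω → V) (w : V) :
    ∫ ω, ‖t • Z ω - t • w‖ ^ 2 ∂P = t ^ 2 * ∫ ω, ‖Z ω - w‖ ^ 2 ∂P := by
  simp_rw [← smul_sub, norm_smul, mul_pow, Real.norm_eq_abs, sq_abs]
  rw [integral_const_mul]

/-- Because `k - 1 ≥ k / 2`: normalising by `k - 1` turns a variance linear in the segment length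
`k` into one of order `1 / k`. -/
theorem sq_inv_sub_one_mul_le {k : ℝ} (hk : 2 ≤ k) : (k - 1)⁻¹ ^ 2 * k ≤ 4 / k := by
  rw [inv_pow, inv_mul_le_iff₀ (by nlinarith), ← mul_div_assoc, le_div_iff₀ (by linarith)]
  nlinarith

/-- The average over the segments of the unbiased segment covariances has variance `O(1 / n)`. -/
theorem BoundedSample.integral_norm_pooled_sub_sq_le (h : BoundedSample P Φ X n R)
    (hB : ∀ f g, ‖B f g‖ ≤ ‖f‖ * ‖g‖) (ha : 2 ≤ a) (han : a ≤ n) :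
    ∫ ω, ‖((n / a : ℕ) : ℝ)⁻¹ • ∑ m ∈ Finset.range (n / a), (((segment n a m).card : ℝ) - 1)⁻¹ •
          bilinScatter B (segment n a m) (fun i => Φ (X i ω))
        - ((n / a : ℕ) : ℝ)⁻¹ • ∑ m ∈ Finset.range (n / a), (((segment n a m).card : ℝ) - 1)⁻¹ •
          ∫ ω', bilinScatter B (segment n a m) (fun i => Φ (X i ω')) ∂P‖ ^ 2 ∂P
      ≤ 80 * R ^ 4 / n := by
  have ha0 : 0 < a := by omega
  have hpos : 0 < n / a := Nat.div_pos han ha0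
  have hr : (0 : ℝ) < ((n / a : ℕ) : ℝ) := by exact_mod_cast hpos
  have ha' : (2 : ℝ) ≤ a := by exact_mod_cast ha
  have hmem : ∀ m ∈ Finset.range (n / a),
      MemLp (fun ω => bilinScatter B (segment n a m) (fun i => Φ (X i ω))) ⊤ P := fun m hm =>
    h.memLp_bilinScatter fun i hi => segment_lt ha0 (Finset.mem_range.1 hm) hi
  rw [integral_norm_smul_sub_sq]
  have hsum := integral_norm_sum_sub_sq (P := P) (Finset.range (n / a))
    (Z := fun m ω => (((segment n a m).card : ℝ) - 1)⁻¹ •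
      bilinScatter B (segment n a m) (fun i => Φ (X i ω)))
    (fun m hm => (hmem m hm).const_smul _) (by
      intro m hm m' hm' hne
      simp_rw [inner_smul_left, inner_smul_right, integral_const_mul, integral_smul,
        inner_smul_left, inner_smul_right]
      rw [h.integral_inner_bilinScatter
        (fun i hi => segment_lt ha0 (Finset.mem_range.1 hm) hi)
        (fun i hi => segment_lt ha0 (Finset.mem_range.1 hm') hi)
        (disjoint_segment ha0 (Finset.mem_range.1 hm) (Finset.mem_range.1 hm') hne)])
  simp_rw [integral_smul, integral_norm_smul_sub_sq] at hsum
  rw [hsum]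
  have hterm : ∀ m ∈ Finset.range (n / a), (((segment n a m).card : ℝ) - 1)⁻¹ ^ 2 *
      ∫ ω, ‖bilinScatter B (segment n a m) (fun i => Φ (X i ω))
        - ∫ ω', bilinScatter B (segment n a m) (fun i => Φ (X i ω')) ∂P‖ ^ 2 ∂P
      ≤ 40 * R ^ 4 / a := by
    intro m hm
    have hka : (a : ℝ) ≤ (segment n a m).card := by
      exact_mod_cast le_card_segment (Finset.mem_range.1 hm)
    have h1 := h.integral_norm_bilinScatter_sub_sq_le hB (S := segment n a m)
      fun i hi => segment_lt ha0 (Finset.mem_range.1 hm) hi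
    have h2 := sq_inv_sub_one_mul_le (ha'.trans hka)
    have h3 : 4 / ((segment n a m).card : ℝ) ≤ 4 / a :=
      div_le_div_of_nonneg_left (by norm_num) (by linarith) hka
    have h4 := mul_le_mul_of_nonneg_left (h2.trans h3) (show 0 ≤ 10 * R ^ 4 by positivity)
    refine (mul_le_mul_of_nonneg_left h1 (sq_nonneg _)).trans ?_
    calc _ = 10 * R ^ 4 * ((((segment n a m).card : ℝ) - 1)⁻¹ ^ 2 * (segment n a m).card) := by ring
      _ ≤ _ := h4
      _ = _ := by ring
  have hs := Finset.sum_le_card_nsmul _ _ _ hterm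
  rw [Finset.card_range, nsmul_eq_mul] at hs
  refine (mul_le_mul_of_nonneg_left hs (sq_nonneg _)).trans ?_
  have hinv := inv_card_segments_le ha0 han
  -- There are `r` uncorrelated terms of variance at most `40 R ^ 4 / a`, weighted by `r⁻¹ ^ 2`;
  -- then `r⁻¹ ≤ 2 a / n`.
  calc _ = ((n / a : ℕ) : ℝ)⁻¹ * (40 * R ^ 4 / a) := by field_simp
    _ ≤ 2 * (a / n : ℝ) * (40 * R ^ 4 / a) := mul_le_mul_of_nonneg_right hinv (by positivity)
    _ = _ := by
      have : (a : ℝ) ≠ 0 := by linarith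
      field_simp
      ring

/-- The expectation of `bilinDeltaHat`, written termwise. -/
noncomputable def bilinDeltaMean (B : H →L[ℝ] H →L[ℝ] V) (P : Measure Ω) (Φ : 𝒳 → H)
    (X : ℕ → Ω → 𝒳) (n a : ℕ) : V :=
  (n : ℝ)⁻¹ • ∫ ω, bilinScatter B (Finset.range n) (fun i => Φ (X i ω)) ∂P -
    ((n / a : ℕ) : ℝ)⁻¹ • ∑ m ∈ Finset.range (n / a), (((segment n a m).card : ℝ) - 1)⁻¹ •
      ∫ ω, bilinScatter B (segment n a m) (fun i => Φ (X i ω)) ∂P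

theorem BoundedSample.memLp_bilinDeltaHat (h : BoundedSample P Φ X n R) (ha : 0 < a) :
    MemLp (fun ω => bilinDeltaHat B n a fun i => Φ (X i ω)) ⊤ P := by
  have h1 : MemLp (fun ω => bilinScatter B (Finset.range n) fun i => Φ (X i ω)) ⊤ P :=
    h.memLp_bilinScatter fun i hi => Finset.mem_range.1 hi
  have h2 : MemLp (fun ω => ∑ m ∈ Finset.range (n / a), (((segment n a m).card : ℝ) - 1)⁻¹ •
      bilinScatter B (segment n a m) (fun i => Φ (X i ω))) ⊤ P :=
    memLp_finsetSum _ fun m hm => (h.memLp_bilinScatter fun i hi =>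
      segment_lt ha (Finset.mem_range.1 hm) hi).const_smul _
  exact (h1.const_smul _).sub (h2.const_smul _)

/-- The variance of `bilinDeltaHat` is `O(1 / n)`. -/
theorem BoundedSample.integral_norm_bilinDeltaHat_sub_sq_le (h : BoundedSample P Φ X n R)
    (hB : ∀ f g, ‖B f g‖ ≤ ‖f‖ * ‖g‖) (ha : 2 ≤ a) (han : a ≤ n) :
    ∫ ω, ‖bilinDeltaHat B n a (fun i => Φ (X i ω)) - bilinDeltaMean B P Φ X n a‖ ^ 2 ∂P
      ≤ 180 * R ^ 4 / n := by
  have ha0 : 0 < a := by omega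
  have hn : (0 : ℝ) < n := by exact_mod_cast ha0.trans_le han
  have h1 : MemLp (fun ω => bilinScatter B (Finset.range n) fun i => Φ (X i ω)) ⊤ P :=
    h.memLp_bilinScatter fun i hi => Finset.mem_range.1 hi
  have h2 : MemLp (fun ω => ∑ m ∈ Finset.range (n / a), (((segment n a m).card : ℝ) - 1)⁻¹ •
      bilinScatter B (segment n a m) (fun i => Φ (X i ω))) ⊤ P :=
    memLp_finsetSum _ fun m hm => (h.memLp_bilinScatter fun i hi =>
      segment_lt ha0 (Finset.mem_range.1 hm) hi).const_smul _
  have v1 : ∫ ω, ‖(n : ℝ)⁻¹ • bilinScatter B (Finset.range n) (fun i => Φ (X i ω))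
      - (n : ℝ)⁻¹ • ∫ ω', bilinScatter B (Finset.range n) (fun i => Φ (X i ω')) ∂P‖ ^ 2 ∂P
      ≤ 10 * R ^ 4 / n := by
    rw [integral_norm_smul_sub_sq]
    have := h.integral_norm_bilinScatter_sub_sq_le hB (S := Finset.range n)
      fun i hi => Finset.mem_range.1 hi
    refine (mul_le_mul_of_nonneg_left this (sq_nonneg _)).trans (le_of_eq ?_)
    rw [Finset.card_range]
    field_simp
  have v2 := h.integral_norm_pooled_sub_sq_le hB ha han
  have i0 := integrable_norm_sq (memLp_sub_const (h.memLp_bilinDeltaHat (B := B) ha0)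
    (bilinDeltaMean B P Φ X n a))
  have i1 := integrable_norm_sq (memLp_sub_const (h1.const_smul (n : ℝ)⁻¹)
    ((n : ℝ)⁻¹ • ∫ ω', bilinScatter B (Finset.range n) (fun i => Φ (X i ω')) ∂P))
  have i2 := integrable_norm_sq (memLp_sub_const (h2.const_smul ((n / a : ℕ) : ℝ)⁻¹)
    (((n / a : ℕ) : ℝ)⁻¹ • ∑ m ∈ Finset.range (n / a), (((segment n a m).card : ℝ) - 1)⁻¹ •
      ∫ ω, bilinScatter B (segment n a m) (fun i => Φ (X i ω)) ∂P))
  simp only [Pi.smul_apply] at i1 i2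
  refine (integral_mono i0 ((i1.const_mul 2).add (i2.const_mul 2)) fun ω => ?_).trans ?_
  · have hsq : ∀ u w x y : V, ‖(u - w) - (x - y)‖ ^ 2 ≤ 2 * ‖u - x‖ ^ 2 + 2 * ‖w - y‖ ^ 2 := by
      intro u w x y
      have : (u - w) - (x - y) = (u - x) - (w - y) := by abel
      rw [this, ← mul_add]
      exact (pow_le_pow_left₀ (norm_nonneg _) (norm_sub_le _ _) 2).trans add_sq_le
    exact hsq _ _ _ _
  · rw [integral_add' (i1.const_mul 2) (i2.const_mul 2), integral_const_mul, integral_const_mul]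
    refine (add_le_add (mul_le_mul_of_nonneg_left v1 zero_le_two)
      (mul_le_mul_of_nonneg_left v2 zero_le_two)).trans (le_of_eq ?_)
    ring

/-- The bias of `bilinDeltaHat` with respect to the dispersion of the means: only the segments with
indices in `J` contain observations with different means. -/
theorem BoundedSample.norm_bilinDeltaMean_sub_le (h : BoundedSample P Φ X n R)
    (hB : ∀ f g, ‖B f g‖ ≤ ‖f‖ * ‖g‖) (ha : 2 ≤ a) (han : a ≤ n) (J : Finset ℕ)
    (hJ : ∀ m < n / a, m ∉ J → ∀ i ∈ segment n a m, ∀ l ∈ segment n a m,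
      ∫ ω, Φ (X i ω) ∂P = ∫ ω, Φ (X l ω) ∂P) :
    ‖bilinDeltaMean B P Φ X n a
        - (n : ℝ)⁻¹ • bilinScatter B (Finset.range n) fun i => ∫ ω, Φ (X i ω) ∂P‖
      ≤ (6 + 8 * J.card) * R ^ 2 * (a / n) := by
  have ha0 : 0 < a := by omega
  have hn : (0 : ℝ) < n := by exact_mod_cast ha0.trans_le han
  have ha' : (2 : ℝ) ≤ a := by exact_mod_cast ha
  have hpos : 0 < n / a := Nat.div_pos han ha0
  have hr : (0 : ℝ) < ((n / a : ℕ) : ℝ) := by exact_mod_cast hpos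
  have hinv := inv_card_segments_le ha0 han
  have hG : ∀ i < n, ‖bilinCov B P Φ X i‖ ≤ 2 * R ^ 2 := fun i hi => h.norm_bilinCov_le hB hi
  have hm : ∀ i < n, ‖∫ ω, Φ (X i ω) ∂P‖ ≤ R := fun i hi => h.norm_integral_le hi
  have hlt : ∀ m ∈ Finset.range (n / a), ∀ i ∈ segment n a m, i < n := fun m hm i hi =>
    segment_lt ha0 (Finset.mem_range.1 hm) hi
  have hka : ∀ m ∈ Finset.range (n / a), (a : ℝ) ≤ (segment n a m).card := fun m hm => by
    exact_mod_cast le_card_segment (Finset.mem_range.1 hm)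
  have hra : ((n / a : ℕ) : ℝ) * a ≤ n := by exact_mod_cast Nat.div_mul_le_self n a
  have hnlt : (n : ℝ) ≤ ((n / a : ℕ) : ℝ) * a + a := by
    have : n ≤ n / a * a + a := by
      have := Nat.lt_mul_div_succ n ha0
      nlinarith
    exact_mod_cast this
  set r : ℝ := ((n / a : ℕ) : ℝ) with hrdef
  set Γ := bilinCov B P Φ X with hΓ
  set μ : ℕ → H := fun i => ∫ ω, Φ (X i ω) ∂P with hμ
  -- Three sources of bias: unequal weights `1 / n` and `1 / (r |S_m|)` on the covariances, the
  -- degree of freedom lost in `M_n`, and the dispersion of the means inside segments.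
  have hmean : bilinDeltaMean B P Φ X n a - (n : ℝ)⁻¹ • bilinScatter B (Finset.range n) μ
      = (∑ m ∈ Finset.range (n / a), ((n : ℝ)⁻¹ - r⁻¹ * ((segment n a m).card : ℝ)⁻¹) •
          ∑ i ∈ segment n a m, Γ i)
        - ((n : ℝ)⁻¹ * (n : ℝ)⁻¹) • ∑ i ∈ Finset.range n, Γ i
        - r⁻¹ • ∑ m ∈ Finset.range (n / a), (((segment n a m).card : ℝ) - 1)⁻¹ •
          bilinScatter B (segment n a m) μ := by
    have e1 : ∀ m ∈ Finset.range (n / a), (((segment n a m).card : ℝ) - 1)⁻¹ •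
        ∫ ω, bilinScatter B (segment n a m) (fun i => Φ (X i ω)) ∂P
        = ((segment n a m).card : ℝ)⁻¹ • ∑ i ∈ segment n a m, Γ i
          + (((segment n a m).card : ℝ) - 1)⁻¹ • bilinScatter B (segment n a m) μ := by
      intro m hm
      have hk := ha'.trans (hka m hm)
      have hk0 : ((segment n a m).card : ℝ) ≠ 0 := by linarith
      have hk1 : ((segment n a m).card : ℝ) - 1 ≠ 0 := by linarith
      rw [h.integral_bilinScatter (hlt m hm), smul_add, smul_smul]
      congr 2
      field_simp
    rw [bilinDeltaMean, h.integral_bilinScatter fun i hi => Finset.mem_range.1 hi,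
      Finset.sum_congr rfl e1, Finset.card_range]
    have e2 : ∑ m ∈ Finset.range (n / a), ((n : ℝ)⁻¹ - r⁻¹ * ((segment n a m).card : ℝ)⁻¹) •
          ∑ i ∈ segment n a m, Γ i
        = (n : ℝ)⁻¹ • ∑ i ∈ Finset.range n, Γ i
          - r⁻¹ • ∑ m ∈ Finset.range (n / a), ((segment n a m).card : ℝ)⁻¹ •
            ∑ i ∈ segment n a m, Γ i := by
      simp_rw [sub_smul, Finset.sum_sub_distrib, mul_smul, ← Finset.smul_sum]
      rw [sum_segment ha0 han]
    rw [e2, Finset.sum_add_distrib]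
    module
  rw [hmean]
  have hΓsum : ∀ S : Finset ℕ, (∀ i ∈ S, i < n) → ‖∑ i ∈ S, Γ i‖ ≤ S.card * (2 * R ^ 2) := by
    intro S hS
    simpa using norm_sum_le_of_le S fun i hi => hG i (hS i hi)
  -- The weight difference times `|S_m|` is a difference of the nonnegative numbers `(|S_m| - a) /
  -- n` and `r⁻¹ - a / n`. Each of them sums over `m` to `(n - r a) / n ≤ a / n`.
  have t1 : ‖∑ m ∈ Finset.range (n / a), ((n : ℝ)⁻¹ - r⁻¹ * ((segment n a m).card : ℝ)⁻¹) •
      ∑ i ∈ segment n a m, Γ i‖ ≤ 4 * R ^ 2 * (a / n) := by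
    have hterm : ∀ m ∈ Finset.range (n / a),
        ‖((n : ℝ)⁻¹ - r⁻¹ * ((segment n a m).card : ℝ)⁻¹) • ∑ i ∈ segment n a m, Γ i‖
        ≤ 2 * R ^ 2 * ((r⁻¹ - a / n) + ((segment n a m).card - a) / n) := by
      intro m hm
      have hk := hka m hm
      have hk0 : (0 : ℝ) < (segment n a m).card := by linarith
      rw [norm_smul, Real.norm_eq_abs]
      refine (mul_le_mul_of_nonneg_left (hΓsum _ (hlt m hm)) (abs_nonneg _)).trans ?_
      rw [← mul_assoc, mul_comm]
      refine mul_le_mul_of_nonneg_left ?_ (by positivity)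
      rw [← abs_of_pos hk0, ← abs_mul, abs_of_pos hk0]
      have e : ((n : ℝ)⁻¹ - r⁻¹ * ((segment n a m).card : ℝ)⁻¹) * (segment n a m).card
          = -(r⁻¹ - a / n) + ((segment n a m).card - a) / n := by
        field_simp
        ring
      have h1 : 0 ≤ r⁻¹ - a / n := by
        rw [sub_nonneg, div_le_iff₀ hn, inv_mul_eq_div, le_div_iff₀ hr]
        linarith
      have h2 : 0 ≤ ((segment n a m).card - a : ℝ) / n := div_nonneg (by linarith) hn.le
      rw [e]
      exact (abs_add_le _ _).trans (by rw [abs_neg, abs_of_nonneg h1, abs_of_nonneg h2])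
    refine (norm_sum_le_of_le _ hterm).trans ?_
    have hcard : ∑ m ∈ Finset.range (n / a), ((segment n a m).card : ℝ) = n := by
      have := sum_segment (n := n) ha0 han (fun _ => (1 : ℝ))
      simpa using this
    rw [← Finset.mul_sum, Finset.sum_add_distrib, Finset.sum_const, ← Finset.sum_div,
      Finset.sum_sub_distrib, hcard, Finset.sum_const, Finset.card_range, nsmul_eq_mul,
      nsmul_eq_mul, ← hrdef]
    have e : 2 * R ^ 2 * (r * (r⁻¹ - a / n) + (n - r * a) / n)
        = 4 * R ^ 2 * ((n - r * a) / n) := by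
      field_simp
      ring
    rw [e]
    gcongr
    linarith
  have t2 : ‖((n : ℝ)⁻¹ * (n : ℝ)⁻¹) • ∑ i ∈ Finset.range n, Γ i‖ ≤ 2 * R ^ 2 * (a / n) := by
    rw [norm_smul, Real.norm_of_nonneg (by positivity)]
    refine (mul_le_mul_of_nonneg_left (hΓsum _ fun i hi => Finset.mem_range.1 hi)
      (by positivity)).trans ?_
    rw [Finset.card_range]
    have e : (n : ℝ)⁻¹ * (n : ℝ)⁻¹ * (n * (2 * R ^ 2)) = 2 * R ^ 2 * (1 / n) := by
      field_simp
    rw [e]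
    gcongr
    linarith
  -- Segments outside `J` contribute nothing; the others at most `4 R ^ 2` each, as `|S_m| ≤ 2
  -- (|S_m| - 1)`. The weight `r⁻¹ ≤ 2 a / n` makes this `8`.
  have t3 : ‖r⁻¹ • ∑ m ∈ Finset.range (n / a), (((segment n a m).card : ℝ) - 1)⁻¹ •
      bilinScatter B (segment n a m) μ‖ ≤ 8 * J.card * R ^ 2 * (a / n) := by
    classical
    have hterm : ∀ m ∈ Finset.range (n / a), ‖(((segment n a m).card : ℝ) - 1)⁻¹ •
        bilinScatter B (segment n a m) μ‖ ≤ if m ∈ J then 4 * R ^ 2 else 0 := by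
      intro m hmr
      split_ifs with hmJ
      · have hk := ha'.trans (hka m hmr)
        have hk1 : 0 < ((segment n a m).card : ℝ) - 1 := by linarith
        rw [norm_smul, norm_inv, Real.norm_of_nonneg hk1.le, inv_mul_le_iff₀ hk1]
        refine (norm_bilinScatter_le hB fun i hi => hm i (hlt m hmr i hi)).trans ?_
        nlinarith [sq_nonneg R]
      · rw [bilinScatter_eq_zero B (hJ m (Finset.mem_range.1 hmr) hmJ), smul_zero, norm_zero]
    have hs : ‖∑ m ∈ Finset.range (n / a), (((segment n a m).card : ℝ) - 1)⁻¹ •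
        bilinScatter B (segment n a m) μ‖ ≤ J.card * (4 * R ^ 2) := by
      refine (norm_sum_le_of_le _ hterm).trans ?_
      rw [← Finset.sum_filter, Finset.sum_const, nsmul_eq_mul]
      gcongr
      exact fun m hm => (Finset.mem_filter.1 hm).2
    rw [norm_smul, Real.norm_of_nonneg (by positivity)]
    refine (mul_le_mul hinv hs (norm_nonneg _) (by positivity)).trans (le_of_eq ?_)
    ring
  refine (norm_sub_le _ _).trans ((add_le_add ((norm_sub_le _ _).trans (add_le_add t1 t2)) t3).trans
    (le_of_eq ?_))
  ring

end Variance

end CKPCA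

namespace CKPCA

/-! ### Change points, piecewise constant means and proportions. -/

section Regime

theorem sum_regimes {M : Type*} [AddCommMonoid M] (f : ℕ → M) :
    ∀ {k : ℕ} {z : Fin (k + 1) → ℕ}, Monotone z →
      ∑ j : Fin k, ∑ i ∈ Finset.Ico (z j.castSucc) (z j.succ), f i
        = ∑ i ∈ Finset.Ico (z 0) (z (Fin.last k)), f i
  | 0, z, _ => by simp
  | k + 1, z, hz => by
    have ih := sum_regimes f (z := z ∘ Fin.castSucc) (hz.comp Fin.strictMono_castSucc.monotone)
    rw [Fin.sum_univ_castSucc]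
    simp only [Function.comp_apply, Fin.castSucc_zero, ← Fin.succ_castSucc] at ih
    rw [ih, Fin.succ_last]
    exact Finset.sum_Ico_consecutive f (hz (Fin.zero_le _)) (hz (Fin.le_last _))

theorem exists_regime : ∀ {k : ℕ} {z : Fin (k + 1) → ℕ} {i : ℕ}, z 0 ≤ i → i < z (Fin.last k) →
    ∃ j : Fin k, z j.castSucc ≤ i ∧ i < z j.succ
  | 0, z, i, h0, h1 => absurd h1 (by simpa using h0)
  | k + 1, z, i, h0, h1 => by
    rcases lt_or_ge i (z (Fin.last k).castSucc) with h | h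
    · obtain ⟨j, hj⟩ := exists_regime (z := z ∘ Fin.castSucc) (by simpa using h0) h
      refine ⟨j.castSucc, hj.1, ?_⟩
      rw [Fin.succ_castSucc]
      exact hj.2
    · exact ⟨Fin.last k, h, by rwa [Fin.succ_last]⟩

variable {H : Type*} [NormedAddCommGroup H] [InnerProductSpace ℝ H]
  {V : Type*} [NormedAddCommGroup V] [NormedSpace ℝ V]
  {s n : ℕ} {z : Fin (s + 2) → ℕ} {m : ℕ → H} {mu : Fin (s + 1) → H}

/-- The dispersion of piecewise constant means is `bilinDelta` for the empirical proportions. -/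
theorem bilinScatter_means (B : H →L[ℝ] H →L[ℝ] V) (hz : Monotone z) (hz0 : z 0 = 0)
    (hzn : z (Fin.last (s + 1)) = n)
    (hm : ∀ j i, z (Fin.castSucc j) ≤ i → i < z (Fin.succ j) → m i = mu j) :
    (n : ℝ)⁻¹ • bilinScatter B (Finset.range n) m
      = bilinDelta B (fun j => ((z j.succ : ℝ) - z j.castSucc) / n) mu := by
  have hsum : ∀ F : H → V, ∑ i ∈ Finset.range n, F (m i)
      = ∑ j, ((z (Fin.succ j) : ℝ) - z (Fin.castSucc j)) • F (mu j) := by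
    intro F
    have h := sum_regimes (fun i => F (m i)) hz
    rw [hz0, hzn, ← Finset.range_eq_Ico] at h
    rw [← h]
    refine Finset.sum_congr rfl fun j _ => ?_
    rw [Finset.sum_congr rfl fun i hi => by
      rw [hm j i (Finset.mem_Ico.1 hi).1 (Finset.mem_Ico.1 hi).2], Finset.sum_const, Nat.card_Ico,
      ← Nat.cast_smul_eq_nsmul ℝ, Nat.cast_sub (hz Fin.castSucc_lt_succ.le)]
  rw [bilinScatter_eq_sum_sum, Finset.card_range]
  simp_rw [fun x => hsum fun y => B (m x - y) (m x - y)]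
  rw [hsum fun x => ∑ j, ((z (Fin.succ j) : ℝ) - z (Fin.castSucc j)) • B (x - mu j) (x - mu j)]
  simp only [bilinDelta, Finset.smul_sum, smul_smul]
  refine Finset.sum_congr rfl fun i _ => Finset.sum_congr rfl fun j _ => ?_
  congr 1
  rw [mul_inv, div_eq_mul_inv, div_eq_mul_inv]
  ring

/-- Only segments which contain a change point contain different means. -/
theorem eq_of_mem_segment {a : ℕ} (ha : 0 < a) (hz : Monotone z) (hz0 : z 0 = 0)
    (hzn : z (Fin.last (s + 1)) = n)
    (hm : ∀ j i, z (Fin.castSucc j) ≤ i → i < z (Fin.succ j) → m i = mu j)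
    {q : ℕ} (hq : q < n / a)
    (hqJ : q ∉ Finset.univ.image fun j : Fin (s + 2) => min (z j / a) (n / a - 1))
    {i l : ℕ} (hi : i ∈ segment n a q) (hl : l ∈ segment n a q) : m i = m l := by
  -- A change point `z j.succ` lies between two members of segment `q` from different regimes. The
  -- clipped quotient is monotone, so the change point has index `q` too, which `hqJ` excludes.
  have key : ∀ {i l : ℕ} {j j' : Fin (s + 1)}, i ∈ segment n a q → l ∈ segment n a q →
      i < z j.succ → z j'.castSucc ≤ l → j < j' → False := by
    intro i l j j' hi hl hij hlj hjj
    rw [segment_eq_filter ha hq] at hi hl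
    have h1 := (Finset.mem_filter.1 hi).2
    have h2 := (Finset.mem_filter.1 hl).2
    have h3 : z j.succ ≤ l := (hz (Fin.le_castSucc_iff.2 (by simpa using hjj))).trans hlj
    have h4 : i / a ≤ z j.succ / a := Nat.div_le_div_right hij.le
    have h5 : z j.succ / a ≤ l / a := Nat.div_le_div_right h3
    exact hqJ (Finset.mem_image.2 ⟨j.succ, Finset.mem_univ _, by omega⟩)
  obtain ⟨j, hj, hj'⟩ := exists_regime (z := z) (i := i) (by omega)
    (by rw [hzn]; exact segment_lt ha hq hi)
  obtain ⟨k, hk, hk'⟩ := exists_regime (z := z) (i := l) (by omega)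
    (by rw [hzn]; exact segment_lt ha hq hl)
  rcases lt_trichotomy j k with h | h | h
  · exact (key hi hl hj' hk h).elim
  · rw [hm j i hj hj', hm k l hk hk', h]
  · exact (key hl hi hk' hj h).elim

/-- The coefficients are products of proportions, and `p i p j - c i c j` telescopes into two
first-order errors. The limit hypothesis serves only to keep `p` bounded. -/
theorem isBigO_bilinDelta_sub (B : H →L[ℝ] H →L[ℝ] V) {k : ℕ} {p : ℕ → Fin k → ℝ} {c : Fin k → ℝ}
    (mu : Fin k → H) {g : ℕ → ℝ} (hlim : ∀ j, Tendsto (fun n => p n j) atTop (𝓝 (c j)))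
    (hrate : ∀ j, (fun n => p n j - c j) =O[atTop] g) :
    (fun n => bilinDelta B (p n) mu - bilinDelta B c mu) =O[atTop] g := by
  have heq : (fun n => bilinDelta B (p n) mu - bilinDelta B c mu) = fun n =>
      (1 / 2 : ℝ) • ∑ i, ∑ j, (p n i * p n j - c i * c j) • B (mu i - mu j) (mu i - mu j) := by
    funext n
    simp only [bilinDelta, sub_smul, Finset.sum_sub_distrib, smul_sub]
  rw [heq]
  suffices h : ∀ i j, (fun n => (p n i * p n j - c i * c j) • B (mu i - mu j) (mu i - mu j))
      =O[atTop] g by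
    have hs : (fun n => ∑ i, ∑ j, (p n i * p n j - c i * c j) • B (mu i - mu j) (mu i - mu j))
        =O[atTop] g :=
      Asymptotics.IsBigO.fun_sum fun i _ => Asymptotics.IsBigO.fun_sum fun j _ => h i j
    exact hs.const_smul_left _
  intro i j
  have h1 : (fun n => p n i * p n j - c i * c j) =O[atTop] g := by
    have e : (fun n => p n i * p n j - c i * c j)
        = fun n => (p n i - c i) * p n j + c i * (p n j - c j) := by
      funext n; ring
    rw [e]
    have h2 := (hrate i).mul ((hlim j).isBigO_one ℝ)
    simp only [mul_one] at h2
    exact h2.add ((hrate j).const_mul_left _)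
  refine (Asymptotics.IsBigO.of_bound ‖B (mu i - mu j) (mu i - mu j)‖
    (Eventually.of_forall fun n => ?_)).trans h1
  rw [norm_smul, mul_comm]

end Regime

/-! ### Stochastic order bounds. -/

section StochasticOrder

variable {Ω : Type*} [MeasurableSpace Ω] {P : Measure Ω}

theorem rate_nonneg (α : ℕ → ℕ) (n : ℕ) : 0 ≤ rate α n := by
  unfold rate; positivity

/-- Only monotonicity of the outer measure enters, so `Z'` need not be measurable; eigenfunctions
chosen arbitrarily at each outcome are allowed. -/
theorem IsBigOp.of_abs_le_mul {Z Z' : ℕ → Ω → ℝ} {a : ℕ → ℝ} (h : IsBigOp P Z a) {K : ℝ}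
    (hK : 0 < K) (hle : ∀ n ω, |Z' n ω| ≤ K * |Z n ω|) : IsBigOp P Z' a := by
  intro ε hε
  obtain ⟨M, hM, hev⟩ := h ε hε
  refine ⟨K * M, mul_pos hK hM, hev.mono fun n hn => (measure_mono fun ω hω => ?_).trans hn⟩
  have h1 : K * M * a n < |Z' n ω| := hω
  have h2 := h1.trans_le (hle n ω)
  rw [mul_assoc] at h2
  exact lt_of_mul_lt_mul_left h2 hK.le

/-- Chebyshev's inequality as a stochastic order bound. -/
theorem isBigOp_of_secondMoment [IsProbabilityMeasure P] {E : Type*} [NormedAddCommGroup E]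
    {Z : ℕ → Ω → ℝ}
    {W : ℕ → Ω → E} {d : ℕ → ℝ} {α : ℕ → ℕ} {K : ℝ} (hK : 0 ≤ K)
    (hZ : ∀ᶠ n in atTop, ∀ ω, |Z n ω| ≤ ‖W n ω‖ + d n)
    (hW : ∀ᶠ n in atTop, Integrable (fun ω => ‖W n ω‖ ^ 2) P ∧ ∫ ω, ‖W n ω‖ ^ 2 ∂P ≤ K / n)
    (hd : d =O[atTop] rate α) : IsBigOp P Z (rate α) := by
  intro ε hε
  obtain ⟨M₁, hM₁, hbd⟩ := hd.exists_pos
  -- Chosen so that `K / M₂ ^ 2 ≤ ε`; the `+ 1` keeps it positive when `K = 0`.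
  set M₂ : ℝ := Real.sqrt (K / ε) + 1 with hM₂
  have hM₂pos : 0 < M₂ := by positivity
  have hKM : K / M₂ ^ 2 ≤ ε := by
    rw [div_le_iff₀ (by positivity), mul_comm, ← div_le_iff₀ hε]
    have h1 : K / ε = Real.sqrt (K / ε) ^ 2 := (Real.sq_sqrt (by positivity)).symm
    rw [h1]
    exact pow_le_pow_left₀ (Real.sqrt_nonneg _) (by linarith) 2
  refine ⟨M₁ + M₂, by positivity, ?_⟩
  filter_upwards [hZ, hW, hbd.bound, eventually_gt_atTop 0] with n hZn hWn hdn hn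
  have hn' : (0 : ℝ) < n := by exact_mod_cast hn
  -- `M₁` pays for the deterministic part `d n`, so the excess must come from `W`, on the smaller
  -- scale `n^{-1/2}`.
  have hsub : {ω | (M₁ + M₂) * rate α n < |Z n ω|} ⊆ {ω | M₂ ^ 2 / n ≤ ‖W n ω‖ ^ 2} := by
    intro ω hω
    have h1 : (M₁ + M₂) * rate α n < |Z n ω| := hω
    have h2 : d n ≤ M₁ * rate α n := by
      have := (le_abs_self (d n)).trans hdn
      rwa [Real.norm_of_nonneg (rate_nonneg α n)] at this
    have h3 : Real.sqrt (1 / n) ≤ rate α n := by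
      unfold rate
      have : (0 : ℝ) ≤ (α n : ℝ) / n := by positivity
      linarith
    have h4 : M₂ * Real.sqrt (1 / n) ≤ ‖W n ω‖ := by
      have h5 := mul_le_mul_of_nonneg_left h3 hM₂pos.le
      have h6 := hZn ω
      linarith
    have h7 := pow_le_pow_left₀ (by positivity) h4 2
    rw [mul_pow, Real.sq_sqrt (by positivity), mul_one_div] at h7
    exact h7
  refine (measure_mono hsub).trans ?_
  have hmk := mul_meas_ge_le_integral_of_nonneg
    (Eventually.of_forall fun ω => sq_nonneg ‖W n ω‖) hWn.1 (M₂ ^ 2 / n)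
  have h8 : P.real {ω | M₂ ^ 2 / n ≤ ‖W n ω‖ ^ 2} ≤ K / M₂ ^ 2 := by
    have h9 := hmk.trans hWn.2
    rw [le_div_iff₀ (by positivity)]
    rw [div_mul_eq_mul_div, div_le_div_iff_of_pos_right hn'] at h9
    linarith
  rw [← ofReal_measureReal]
  exact ENNReal.ofReal_le_ofReal (h8.trans hKM)

end StochasticOrder

/-! ### Assembly of the rate and the main theorem. -/

section Main

theorem norm_feature_sq {𝒳 H : Type*} [NormedAddCommGroup H] [InnerProductSpace ℝ H]
    [CompleteSpace H] [RKHS ℝ H 𝒳 ℝ] (x : 𝒳) : ‖feature H x‖ ^ 2 = kern H x x := by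
  have := RKHS.kernel_inner H x x (1 : ℝ) (1 : ℝ)
  rw [← real_inner_self_eq_norm_sq, feature, ← this, kern]
  simp

variable {Ω : Type*} [MeasurableSpace Ω] {P : Measure Ω} [IsProbabilityMeasure P]
  {𝒳 : Type*} [MeasurableSpace 𝒳]
  {H : Type*} [NormedAddCommGroup H] [InnerProductSpace ℝ H] [CompleteSpace H]
  {V : Type*} [NormedAddCommGroup V] [InnerProductSpace ℝ V] [CompleteSpace V]

/-- The three parts of the error meet here: the centred estimator is the random part `W`, while the
bias `d₁` and the error `d₂` in the proportions are deterministic. -/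
theorem isBigOp_norm_bilinDeltaHat_sub {Φ : 𝒳 → H} {X : ℕ → ℕ → Ω → 𝒳} {R : ℝ}
    (B : H →L[ℝ] H →L[ℝ] V) (hB : ∀ f g, ‖B f g‖ ≤ ‖f‖ * ‖g‖)
    (h : ∀ n, BoundedSample P Φ (X n) n R) {s : ℕ} {c : Fin (s + 1) → ℝ} {mu : Fin (s + 1) → H}
    {z : ℕ → Fin (s + 2) → ℕ} (hz : ∀ n, Monotone (z n)) (hz0 : ∀ n, z n 0 = 0)
    (hzn : ∀ n, z n (Fin.last (s + 1)) = n) {α : ℕ → ℕ} (hα : ∀ᶠ n in atTop, 2 ≤ α n ∧ α n ≤ n)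
    (hlim : ∀ j : Fin (s + 1), Tendsto
      (fun n => ((z n j.succ : ℝ) - (z n j.castSucc : ℝ)) / (n : ℝ)) atTop (𝓝 (c j)))
    (hrate : ∀ j : Fin (s + 1),
      (fun n => ((z n j.succ : ℝ) - (z n j.castSucc : ℝ)) / (n : ℝ) - c j) =O[atTop] rate α)
    (hm : ∀ n (j : Fin (s + 1)) i, z n j.castSucc ≤ i → i < z n j.succ →
      ∫ ω, Φ (X n i ω) ∂P = mu j) :
    IsBigOp P (fun n ω => ‖bilinDeltaHat B n (α n) (fun i => Φ (X n i ω)) - bilinDelta B c mu‖)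
      (rate α) := by
  set m : ℕ → ℕ → H := fun n i => ∫ ω, Φ (X n i ω) ∂P with hmdef
  set d₁ : ℕ → V := fun n => bilinDeltaMean B P Φ (X n) n (α n)
    - (n : ℝ)⁻¹ • bilinScatter B (Finset.range n) (m n) with hd₁
  set d₂ : ℕ → V := fun n => bilinDelta B
    (fun j : Fin (s + 1) => ((z n j.succ : ℝ) - (z n j.castSucc : ℝ)) / (n : ℝ)) mu
    - bilinDelta B c mu with hd₂
  refine isBigOp_of_secondMoment (K := 180 * R ^ 4) (d := fun n => ‖d₁ n‖ + ‖d₂ n‖)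
    (W := fun n ω => bilinDeltaHat B n (α n) (fun i => Φ (X n i ω))
      - bilinDeltaMean B P Φ (X n) n (α n)) (by positivity) ?_ ?_ ?_
  · refine Eventually.of_forall fun n ω => ?_
    rw [abs_of_nonneg (norm_nonneg _)]
    have heq : bilinDeltaHat B n (α n) (fun i => Φ (X n i ω)) - bilinDelta B c mu
        = (bilinDeltaHat B n (α n) (fun i => Φ (X n i ω)) - bilinDeltaMean B P Φ (X n) n (α n))
          + (d₁ n + d₂ n) := by
      simp only [hd₁, hd₂]
      rw [bilinScatter_means B (hz n) (hz0 n) (hzn n) (hm n)]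
      abel
    rw [heq]
    exact (norm_add_le _ _).trans (add_le_add_right (norm_add_le _ _) _)
  · filter_upwards [hα] with n hn
    exact ⟨integrable_norm_sq (memLp_sub_const ((h n).memLp_bilinDeltaHat (by omega)) _),
      (h n).integral_norm_bilinDeltaHat_sub_sq_le hB hn.1 hn.2⟩
  · refine Asymptotics.IsBigO.add ?_ ((isBigO_bilinDelta_sub B mu hlim hrate).norm_left)
    refine Asymptotics.IsBigO.of_bound ((6 + 8 * (s + 2)) * R ^ 2) ?_
    filter_upwards [hα] with n hn
    have hα0 : 0 < α n := by omega
    have h1 := (h n).norm_bilinDeltaMean_sub_le hB hn.1 hn.2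
      (Finset.univ.image fun j : Fin (s + 2) => min (z n j / α n) (n / α n - 1))
      fun q hq hqJ i hi l hl =>
        eq_of_mem_segment hα0 (hz n) (hz0 n) (hzn n) (hm n) hq hqJ hi hl
    have hcard : ((Finset.univ.image
        fun j : Fin (s + 2) => min (z n j / α n) (n / α n - 1)).card : ℝ) ≤ s + 2 := by
      have : (Finset.univ.image
        fun j : Fin (s + 2) => min (z n j / α n) (n / α n - 1)).card ≤ s + 2 :=
        Finset.card_image_le.trans (by simp)
      exact_mod_cast this
    rw [norm_norm, Real.norm_of_nonneg (rate_nonneg α n)]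
    refine h1.trans (mul_le_mul ?_ ?_ (by positivity) (by positivity))
    · gcongr
    · unfold rate
      linarith [Real.sqrt_nonneg (1 / (n : ℝ))]

end Main

end CKPCA

theorem theorem3
    {Ω : Type*} [MeasurableSpace Ω] (P : Measure Ω) [IsProbabilityMeasure P]
    -- the data space, and a real reproducing kernel Hilbert space of functions on it
    {𝒳 : Type*} [MeasurableSpace 𝒳]
    {H : Type*} [NormedAddCommGroup H] [InnerProductSpace ℝ H] [CompleteSpace H]
    [RKHS ℝ H 𝒳 ℝ]
    (hΦ : StronglyMeasurable (CKPCA.feature H : 𝒳 → H))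
    -- `s` change points, hence `s + 1` regimes with laws `law j` and limiting proportions `c j`
    (s : ℕ) (law : Fin (s + 1) → Measure 𝒳) [∀ j, IsProbabilityMeasure (law j)]
    (c : Fin (s + 1) → ℝ) (hc : ∀ j, 0 < c j)
    -- for sample size `n`, regime `j` consists of the (0-based) times `z n j ≤ i < z n (j + 1)`
    (z : ℕ → Fin (s + 2) → ℕ) (hz_mono : ∀ n, Monotone (z n))
    (hz_zero : ∀ n, z n 0 = 0) (hz_last : ∀ n, z n (Fin.last (s + 1)) = n)
    -- segment lengths of the estimator
    (α : ℕ → ℕ) (hα : ∀ᶠ n in atTop, 2 ≤ α n ∧ α n ≤ n)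
    -- the proportions converge, not slower than the rate in the claim
    (hz_lim : ∀ j : Fin (s + 1), Tendsto
      (fun n => ((z n j.succ : ℝ) - (z n j.castSucc : ℝ)) / (n : ℝ)) atTop (𝓝 (c j)))
    (hz_rate : ∀ j : Fin (s + 1),
      (fun n => ((z n j.succ : ℝ) - (z n j.castSucc : ℝ)) / (n : ℝ) - c j)
        =O[atTop] CKPCA.rate α)
    -- the observations `X n 0, …, X n (n - 1)`
    (X : ℕ → ℕ → Ω → 𝒳)
    (hX_indep : ∀ n, iIndepFun (fun i : Fin n => X n i) P)
    (hX_law : ∀ n (j : Fin (s + 1)) (i : ℕ), z n j.castSucc ≤ i → i < z n j.succ →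
      HasLaw (X n i) (law j) P)
    -- `K(X_i, X_i)` is bounded
    (C : ℝ) (hK : ∀ n, ∀ i < n, ∀ᵐ ω ∂P, CKPCA.kern H (X n i ω) (X n i ω) ≤ C)
    -- any orthonormal basis, in which the Hilbert–Schmidt norm is computed
    {ι : Type*} (b : HilbertBasis ι ℝ H)
    (mu : Fin (s + 1) → H) (hmu : ∀ j, mu j = CKPCA.meanElement H (law j))
    (Δ : H →L[ℝ] H) (hΔ : Δ = CKPCA.delta c mu)
    (Δhat : ℕ → Ω → H →L[ℝ] H)
    (hΔhat : ∀ n ω, Δhat n ω =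
      CKPCA.deltaHat n (α n) (fun i => CKPCA.feature H (X n i ω))) :
    CKPCA.IsHilbertSchmidt b Δ ∧
    (∀ n ω, CKPCA.IsHilbertSchmidt b (Δhat n ω - Δ)) ∧
    CKPCA.IsBigOp P (fun n ω => CKPCA.hsNorm b (Δhat n ω - Δ)) (CKPCA.rate α) ∧
    -- eigenprojections, for every choice of the leading `q_d` eigenfunctions of `Δ` and `Δhat`
    (∀ (lam : Fin (CKPCA.structuralDim mu) → ℝ) (v : Fin (CKPCA.structuralDim mu) → H)
      (lamhat : ℕ → Ω → Fin (CKPCA.structuralDim mu) → ℝ)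
      (vhat : ℕ → Ω → Fin (CKPCA.structuralDim mu) → H),
      CKPCA.IsLeadingEigensystem Δ lam v →
      (∀ n ω, CKPCA.IsLeadingEigensystem (Δhat n ω) (lamhat n ω) (vhat n ω)) →
      ∀ k : Fin (CKPCA.structuralDim mu),
        CKPCA.IsBigOp P
          (fun n ω => ‖CKPCA.spanProj (vhat n ω) {l | lam l = lam k}
            - CKPCA.spanProj v {l | lam l = lam k}‖)
          (CKPCA.rate α)) := by
  have hbound : ∀ n, ∀ i < n, ∀ᵐ ω ∂P, ‖CKPCA.feature H (X n i ω)‖ ≤ Real.sqrt C := by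
    intro n i hi
    filter_upwards [hK n i hi] with ω hω
    rw [← CKPCA.norm_feature_sq] at hω
    exact Real.le_sqrt_of_sq_le hω
  have hregime : ∀ n i, i < n → ∃ j : Fin (s + 1), z n j.castSucc ≤ i ∧ i < z n j.succ := by
    intro n i hi
    exact CKPCA.exists_regime (by rw [hz_zero]; exact i.zero_le) (by rwa [hz_last])
  have hsample : ∀ n, CKPCA.BoundedSample P (CKPCA.feature H) (X n) n (Real.sqrt C) := fun n =>
    { meas := hΦ
      aem := fun i hi => by
        obtain ⟨j, hj, hj'⟩ := hregime n i hi
        exact (hX_law n j i hj hj').aemeasurable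
      indep := hX_indep n
      nonneg := Real.sqrt_nonneg C
      bound := hbound n }
  have hmean : ∀ n (j : Fin (s + 1)) i, z n j.castSucc ≤ i → i < z n j.succ →
      ∫ ω, CKPCA.feature H (X n i ω) ∂P = mu j := by
    intro n j i hi hi'
    rw [hmu]
    exact (hX_law n j i hi hi').integral_comp hΦ.aestronglyMeasurable
  -- From here the Hilbert–Schmidt norm is the norm of a random element of a Hilbert space, to which
  -- the second moment bounds apply.
  have hrep : ∀ n ω, CKPCA.Represents b (Δhat n ω - Δ)
      (CKPCA.bilinDeltaHat (CKPCA.hsTensor b) n (α n) (fun i => CKPCA.feature H (X n i ω))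
        - CKPCA.bilinDelta (CKPCA.hsTensor b) c mu) := by
    intro n ω
    rw [hΔhat, hΔ]
    exact (CKPCA.represents_deltaHat _ _ _).sub (CKPCA.represents_delta _ _)
  have hrate : CKPCA.IsBigOp P (fun n ω => CKPCA.hsNorm b (Δhat n ω - Δ)) (CKPCA.rate α) := by
    have h := CKPCA.isBigOp_norm_bilinDeltaHat_sub (CKPCA.hsTensor b) (CKPCA.norm_hsTensor_le b)
      hsample hz_mono hz_zero hz_last hα hz_lim hz_rate hmean
    have heq : (fun n ω => CKPCA.hsNorm b (Δhat n ω - Δ)) = fun n ω =>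
        ‖CKPCA.bilinDeltaHat (CKPCA.hsTensor b) n (α n) (fun i => CKPCA.feature H (X n i ω))
          - CKPCA.bilinDelta (CKPCA.hsTensor b) c mu‖ := by
      funext n ω
      exact (hrep n ω).hsNorm_eq
    rw [heq]
    exact h
  refine ⟨?_, fun n ω => (hrep n ω).isHilbertSchmidt, hrate, ?_⟩
  · rw [hΔ]
    exact (CKPCA.represents_delta c mu).isHilbertSchmidt
  · intro lam v lamhat vhat hv hvhat k
    subst hΔ
    obtain ⟨hpos, hker⟩ := hv.delta_pos_and_ker hc
    -- `K` depends on the population operator alone, so one constant serves every `n` and every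
    -- outcome.
    obtain ⟨K, hKpos, hle⟩ := CKPCA.exists_norm_spanProj_sub_le
      (CKPCA.isSymmFiniteRank_delta c mu) hv hpos hker k
    refine hrate.of_abs_le_mul hKpos fun n ω => ?_
    have hfr : CKPCA.IsSymmFiniteRank (Δhat n ω) := by
      rw [hΔhat]
      exact CKPCA.isSymmFiniteRank_deltaHat _ _ _
    rw [abs_of_nonneg (norm_nonneg _), (hrep n ω).hsNorm_eq, abs_of_nonneg (norm_nonneg _)]
    exact (hle _ _ _ hfr (hvhat n ω)).trans
      (mul_le_mul_of_nonneg_left (hrep n ω).norm_le hKpos.le)
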